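/- Let $\{B(t)\}_{t\ge 0}$ be a one-dimensional standard Brownian motion on a probability space $(\Omega,\mathcal F,\mathbb P)$. Let $a,c\in\mathbb R$ with $c<-a-c<a$ (so $c<0<a$), put $\mathcal B=(a^2+c^2+ac)/3$, and let $y\in[c,-a-c]$ and $\eta\in\mathbb R$ satisfy $$\frac{\eta^2}{2}-\frac{y^3}{3}+\mathcal B y=\frac{ac(a+c)}{3}.$$ Let $x_0$ be the solution on $[0,\infty)$ of $$\ddot x_0=x_0^2-\mathcal B,\qquad x_0(0)=y,\quad \dot x_0(0)=\eta .$$ Let the processes $x_n$, $n\ge 1$, on $[0,\infty)$ be the solutions (almost surely, pathwise) of $$\ddot x_1(t)=2x_0(t)x_1(t)+\dot B(t),\qquad x_1(0)=\dot x_1(0)=0,$$ understood as $dx_1=\xi_1\,dt$, $d\xi_1=2x_0x_1\,dt+dB$, $x_1(0)=\xi_1(0)=0$, and, for $n\ge 2$, $$\ddot x_n(t)=2x_0(t)x_n(t)+\sum_{j=1}^{n-1}x_j(t)x_{n-j}(t),\qquad x_n(0)=\dot x_n(0)=0 .$$ Let $q=\sqrt{(2c+a)/(c-a)}\in(0,1)$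 and $F(\varphi,q)=\int_0^\varphi(1-q^2\sin^2\alpha)^{-1/2}\,d\alpha$, let $\mathrm{sn},\mathrm{cn},\mathrm{dn}$ be the Jacobi elliptic functions and $\mathcal E(t,q)=\int_0^t\mathrm{dn}^2(s,q)\,ds$. Put $$u_1(t)=\mathrm{sn}(t,q)\,\mathrm{cn}(t,q)\,\mathrm{dn}(t,q),$$ $$\begin{aligned}u_2(t)={}&(-1+q^2)+(-2q^6+3q^4-5q^2+2)\,\mathrm{cn}^2(t,q)+2q^2(q^4-q^2+1)\,\mathrm{cn}^4(t,q)\\&+\big[(-q^4+3q^2-2)\,t+2(q^4-q^2+1)\,\mathcal E(t,q)\big]u_1(t),\end{aligned}$$ and, for $i=1,2$, $$w_i(t)=k_i\,u_i\Big(\sqrt{\tfrac{a-c}{6}}\;t+\theta\Big),\qquad \theta=\pm F\Big(\arcsin\sqrt{\tfrac{c-y}{2c+a}},\,q\Big),$$ where the sign is $+$ if $\eta\ge 0$ and $-$ if $\eta<0$, and where $k_1,k_2\in\mathbb R$ are constants such that the Wronskian $w_1\dot w_2-\dot w_1w_2$ equals $1$. (These are linearly independent solutions of $\ddot w=2x_0w$.)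 Put $K(t,s)=w_2(t)w_1(s)-w_1(t)w_2(s)$ and define, for $t\ge 0$, $$\gamma_1(t)=|w_1(t)|+|w_2(t)|,\qquad \gamma_n(t)=\int_0^t|K(t,s)|\sum_{j=1}^{n-1}\gamma_j(s)\gamma_{n-j}(s)\,ds\quad(n\ge 2).$$ Then for every $\sigma>0$, $T>0$ and $n\ge 1$, $$\mathbb P\Big(|x_n(t)|\le\frac{\gamma_n(t)}{\sigma^n}\ \text{for all } t\in[0,T]\Big)\ \ge\ 1-\sigma\,2^{(n-2)^+}\sqrt{\frac{2}{\pi}}\,\Big(\|w_1\|_{L^2([0,T])}+\|w_2\|_{L^2([0,T])}\Big),$$ where $(n-2)^+=\max\{n-2,0\}$. -/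

import Mathlib

open MeasureTheory ProbabilityTheory Set
open scoped NNReal

noncomputable section

namespace CubicOscillator

/-- The elliptic integral of the first kind `F(φ, q) = ∫₀^φ dα / √(1 - q² sin² α)`. -/
def ellipticF (φ q : ℝ) : ℝ :=
  ∫ α in (0 : ℝ)..φ, 1 / Real.sqrt (1 - q ^ 2 * Real.sin α ^ 2)

/-- The Jacobi amplitude: the inverse function of `φ ↦ F(φ, q)`, which for `0 < q < 1` is a
bijection of `ℝ`. -/
def am (u q : ℝ) : ℝ := Function.invFun (fun φ : ℝ => ellipticF φ q) u

/-- The Jacobi elliptic sine: `sn(u, q) = sin φ` where `u = F(φ, q)`. -/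
def sn (u q : ℝ) : ℝ := Real.sin (am u q)

/-- The Jacobi elliptic cosine. -/
def cn (u q : ℝ) : ℝ := Real.cos (am u q)

/-- The Jacobi delta amplitude. -/
def dn (u q : ℝ) : ℝ := Real.sqrt (1 - q ^ 2 * sn u q ^ 2)

/-- Jacobi's epsilon function. -/
def jacobiEpsilon (u q : ℝ) : ℝ := ∫ s in (0 : ℝ)..u, dn s q ^ 2

/-- The first solution of Lamé's equation `u'' + (4 + 4 q² - 12 q² sn²(t, q)) u = 0`. -/
def u₁ (q t : ℝ) : ℝ := sn t q * cn t q * dn t q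

/-- The second solution of the same equation. -/
def u₂ (q t : ℝ) : ℝ :=
  (-1 + q ^ 2) + (-2 * q ^ 6 + 3 * q ^ 4 - 5 * q ^ 2 + 2) * cn t q ^ 2
    + 2 * q ^ 2 * (q ^ 4 - q ^ 2 + 1) * cn t q ^ 4
    + ((-q ^ 4 + 3 * q ^ 2 - 2) * t + 2 * (q ^ 4 - q ^ 2 + 1) * jacobiEpsilon t q) * u₁ q t

/-- The Hamiltonian `H(x, ξ) = ξ²/2 - x³/3 + 𝓑 x`. -/
def hamiltonian (b x ξ : ℝ) : ℝ := ξ ^ 2 / 2 - x ^ 3 / 3 + b * x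

/-- The constant `𝓑 = (a² + c² + ac)/3`. -/
def calB (a c : ℝ) : ℝ := (a ^ 2 + c ^ 2 + a * c) / 3

/-- The modulus `q = √((2c + a)/(c - a))`. -/
def modulus (a c : ℝ) : ℝ := Real.sqrt ((2 * c + a) / (c - a))

/-- The phase at time `0`, of absolute value `F(arcsin √((c - y)/(2c + a)), q)` and with the sign
of the initial velocity `η` (the sign is `+` if `η = 0`). -/
def phase (a c y η : ℝ) : ℝ :=
  if η < 0 then -ellipticF (Real.arcsin (Real.sqrt ((c - y) / (2 * c + a)))) (modulus a c)
  else ellipticF (Real.arcsin (Real.sqrt ((c - y) / (2 * c + a)))) (modulus a c)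

/-- `t ↦ k · u₁(√((a - c)/6) t + i)`, with `i` the phase and `k` a normalizing constant. -/
def w₁ (a c y η k t : ℝ) : ℝ :=
  k * u₁ (modulus a c) (Real.sqrt ((a - c) / 6) * t + phase a c y η)

/-- `t ↦ k · u₂(√((a - c)/6) t + i)`, with `i` the phase and `k` a normalizing constant. -/
def w₂ (a c y η k t : ℝ) : ℝ :=
  k * u₂ (modulus a c) (Real.sqrt ((a - c) / 6) * t + phase a c y η)

/-- `x₀` solves `x₀' = ξ₀`, `ξ₀' = x₀² - 𝓑` on `[0, ∞)` with `x₀(0) = y`, `ξ₀(0) = η`. -/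
def IsUnperturbedSolution (b y η : ℝ) (x₀ : ℝ → ℝ) : Prop :=
  ∃ ξ₀ : ℝ → ℝ, x₀ 0 = y ∧ ξ₀ 0 = η ∧
    (∀ t, 0 ≤ t → HasDerivWithinAt x₀ (ξ₀ t) (Ici 0) t) ∧
    (∀ t, 0 ≤ t → HasDerivWithinAt ξ₀ (x₀ t ^ 2 - b) (Ici 0) t)

/-- The path `x` solves on `[0, ∞)` the system `dx = ξ dt`, `dξ = 2 x₀ x dt + dF`, `x(0) = 0`,
`ξ(0) = 0`, in integrated form; here `F` is a continuous path with `F(0) = 0`. -/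
def SolvesLinearized (x₀ F x : ℝ → ℝ) : Prop :=
  ∃ ξ : ℝ → ℝ, ContinuousOn ξ (Ici 0) ∧
    (∀ t, 0 ≤ t → x t = ∫ s in (0 : ℝ)..t, ξ s) ∧
    (∀ t, 0 ≤ t → ξ t = (∫ s in (0 : ℝ)..t, 2 * x₀ s * x s) + F t)

/-- The processes `x₁, x₂, …` are the coefficients of the expansion in the noise intensity: almost
surely, `x₁'' = 2 x₀ x₁ + dB/dt` and `xₙ'' = 2 x₀ xₙ + ∑_{1 ≤ j ≤ n - 1} x_j x_{n - j}` for
`n ≥ 2`, all with zero initial data. (The value `x 0` plays no role.) -/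
structure IsExpansion {Ω : Type*} [MeasurableSpace Ω] (P : Measure Ω) (B : ℝ≥0 → Ω → ℝ)
    (x₀ : ℝ → ℝ) (x : ℕ → ℝ → Ω → ℝ) : Prop where
  first : ∀ᵐ ω ∂P, SolvesLinearized x₀ (fun t => B t.toNNReal ω) (fun t => x 1 t ω)
  higher : ∀ n : ℕ, 2 ≤ n → ∀ᵐ ω ∂P, SolvesLinearized x₀
    (fun t => ∫ s in (0 : ℝ)..t, ∑ j ∈ Finset.Ico 1 n, x j s ω * x (n - j) s ω)
    (fun t => x n t ω)

/-- The kernel `K(t, s) = w₂(t) w₁(s) - w₁(t) w₂(s)`. -/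
def kernel (v₁ v₂ : ℝ → ℝ) (t s : ℝ) : ℝ := v₂ t * v₁ s - v₁ t * v₂ s

/-- `γ₁ = |w₁| + |w₂|` and, for `n ≥ 2`,
`γₙ(t) = ∫₀ᵗ |K(t, s)| ∑_{1 ≤ j ≤ n - 1} γ_j(s) γ_{n - j}(s) ds`; see `gammaSeq_of_two_le`.
(The value at index `0` plays no role.) -/
def gammaSeq (v₁ v₂ : ℝ → ℝ) : ℕ → ℝ → ℝ
  | 0 => fun _ => 0
  | 1 => fun t => |v₁ t| + |v₂ t|
  | n + 2 => fun t => ∫ s in (0 : ℝ)..t, |kernel v₁ v₂ t s| *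
      ∑ j : Fin (n + 1), gammaSeq v₁ v₂ (1 + j) s * gammaSeq v₁ v₂ (n + 2 - (1 + j)) s
termination_by n => n
decreasing_by all_goals omega

theorem gammaSeq_of_two_le (v₁ v₂ : ℝ → ℝ) (n : ℕ) (hn : 2 ≤ n) (t : ℝ) :
    gammaSeq v₁ v₂ n t = ∫ s in (0 : ℝ)..t, |kernel v₁ v₂ t s| *
      ∑ j ∈ Finset.Ico 1 n, gammaSeq v₁ v₂ j s * gammaSeq v₁ v₂ (n - j) s := by
  obtain ⟨m, rfl⟩ := Nat.exists_eq_add_of_le' hn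
  rw [gammaSeq]
  refine intervalIntegral.integral_congr fun s _ => ?_
  congr 1
  rw [Finset.sum_Ico_eq_sum_range, Finset.sum_range]
  rfl

/-- The norm of `L²([0, T])`. -/
def L2norm (T : ℝ) (f : ℝ → ℝ) : ℝ := (eLpNorm f 2 (volume.restrict (Icc 0 T))).toReal

end CubicOscillator

end

/-!
Since `w₁` and `w₂` solve `w'' = 2 x₀ w` and have Wronskian one, variation of constants gives
`x₁(t) = w₂(t) ∫₀ᵗ w₁ dB - w₁(t) ∫₀ᵗ w₂ dB` and, for `n ≥ 2`,
`xₙ(t) = ∫₀ᵗ K(t, s) ∑ x_j(s) x_{n - j}(s) ds`. On the event that both Wiener integrals stay within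
`[-1/σ, 1/σ]` on `[0, T]` we get `|x₁| ≤ γ₁/σ`, and the recursion propagates this to
`|xₙ| ≤ γₙ/σⁿ` for all `n` simultaneously. Doob's maximal inequality bounds the probability that
`∫ w dB` leaves `[-1/σ, 1/σ]` by `σ E|∫₀ᵀ w dB| = σ √(2/π) ‖w‖`, the integral being centred Gaussian
with variance `‖w‖²`. Since `w` is smooth, `∫ w dB` may be defined pathwise by integration by parts;
it is then a uniform limit of sums over partitions, to which the discrete maximal inequality
applies.
-/

namespace CubicOscillator

open scoped Real

/-! ### Jacobi elliptic functions and Lamé's equation -/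

section Jacobi

variable {q : ℝ}

theorem one_sub_sq_mul_sin_sq_pos (hq : q ^ 2 < 1) (α : ℝ) : 0 < 1 - q ^ 2 * Real.sin α ^ 2 :=
  sub_pos.2 ((mul_le_of_le_one_right (sq_nonneg q) (Real.sin_sq_le_one α)).trans_lt hq)

theorem sqrt_one_sub_sq_mul_sin_sq_pos (hq : q ^ 2 < 1) (α : ℝ) :
    0 < √(1 - q ^ 2 * Real.sin α ^ 2) :=
  Real.sqrt_pos.2 (one_sub_sq_mul_sin_sq_pos hq α)

theorem hasDerivAt_ellipticF (hq : q ^ 2 < 1) (φ : ℝ) :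
    HasDerivAt (fun φ => ellipticF φ q) (1 / √(1 - q ^ 2 * Real.sin φ ^ 2)) φ := by
  have hcont : Continuous fun α : ℝ => 1 / √(1 - q ^ 2 * Real.sin α ^ 2) :=
    continuous_const.div (by fun_prop) fun α => (sqrt_one_sub_sq_mul_sin_sq_pos hq α).ne'
  exact intervalIntegral.integral_hasDerivAt_right (hcont.intervalIntegrable _ _)
    (hcont.stronglyMeasurableAtFilter _ _) hcont.continuousAt

theorem continuous_ellipticF (hq : q ^ 2 < 1) : Continuous fun φ => ellipticF φ q :=
  continuous_iff_continuousAt.2 fun φ => (hasDerivAt_ellipticF hq φ).continuousAt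

theorem ellipticF_zero (q : ℝ) : ellipticF 0 q = 0 :=
  intervalIntegral.integral_same

theorem ellipticF_neg (φ q : ℝ) : ellipticF (-φ) q = -ellipticF φ q := by
  have h := intervalIntegral.integral_comp_neg (a := 0) (b := φ)
    (fun α : ℝ => 1 / √(1 - q ^ 2 * Real.sin α ^ 2))
  simp only [Real.sin_neg, neg_sq, neg_zero] at h
  rw [ellipticF, ellipticF, h, intervalIntegral.integral_symm]

theorem strictMono_ellipticF (hq : q ^ 2 < 1) : StrictMono fun φ => ellipticF φ q := by
  refine strictMono_of_deriv_pos fun φ => ?_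
  rw [(hasDerivAt_ellipticF hq φ).deriv]
  exact one_div_pos.2 (sqrt_one_sub_sq_mul_sin_sq_pos hq φ)

theorem monotone_ellipticF_sub_id (hq : q ^ 2 < 1) : Monotone fun φ => ellipticF φ q - φ := by
  refine monotone_of_hasDerivAt_nonneg
    (fun φ => (hasDerivAt_ellipticF hq φ).sub (hasDerivAt_id φ)) fun φ => ?_
  have h_le_one : √(1 - q ^ 2 * Real.sin φ ^ 2) ≤ 1 :=
    Real.sqrt_le_one.2 (sub_le_self 1 (by positivity))
  exact sub_nonneg.2 ((one_le_div (sqrt_one_sub_sq_mul_sin_sq_pos hq φ)).2 h_le_one)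

theorem le_ellipticF (hq : q ^ 2 < 1) {φ : ℝ} (hφ : 0 ≤ φ) : φ ≤ ellipticF φ q := by
  simpa [ellipticF_zero] using monotone_ellipticF_sub_id hq hφ

theorem ellipticF_le (hq : q ^ 2 < 1) {φ : ℝ} (hφ : φ ≤ 0) : ellipticF φ q ≤ φ := by
  simpa [ellipticF_zero] using monotone_ellipticF_sub_id hq hφ

theorem surjective_ellipticF (hq : q ^ 2 < 1) : Function.Surjective fun φ => ellipticF φ q :=
  (continuous_ellipticF hq).surjective
    (Filter.tendsto_atTop_mono' _
      ((Filter.eventually_ge_atTop 0).mono fun _ => le_ellipticF hq) Filter.tendsto_id)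
    (Filter.tendsto_atBot_mono' _
      ((Filter.eventually_le_atBot 0).mono fun _ => ellipticF_le hq) Filter.tendsto_id)

theorem am_ellipticF (hq : q ^ 2 < 1) (φ : ℝ) : am (ellipticF φ q) q = φ :=
  Function.leftInverse_invFun (strictMono_ellipticF hq).injective φ

theorem ellipticF_am (hq : q ^ 2 < 1) (u : ℝ) : ellipticF (am u q) q = u :=
  Function.rightInverse_invFun (surjective_ellipticF hq) u

theorem continuous_am (hq : q ^ 2 < 1) : Continuous fun u => am u q := by
  let e := (strictMono_ellipticF hq).orderIsoOfSurjective _ (surjective_ellipticF hq)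
  have h_symm : (fun u => am u q) = e.symm :=
    funext fun u => e.eq_symm_apply.2 (ellipticF_am hq u)
  exact h_symm ▸ e.symm.continuous

theorem hasDerivAt_am (hq : q ^ 2 < 1) (u : ℝ) : HasDerivAt (fun u => am u q) (dn u q) u := by
  have h := (hasDerivAt_ellipticF hq (am u q)).of_local_left_inverse
    (continuous_am hq).continuousAt (one_div_pos.2 (sqrt_one_sub_sq_mul_sin_sq_pos hq _)).ne'
    (Filter.Eventually.of_forall (ellipticF_am hq))
  rwa [one_div, inv_inv] at h

theorem cn_sq (u q : ℝ) : cn u q ^ 2 = 1 - sn u q ^ 2 :=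
  Real.cos_sq' _

theorem dn_pos (hq : q ^ 2 < 1) (u : ℝ) : 0 < dn u q :=
  sqrt_one_sub_sq_mul_sin_sq_pos hq _

theorem dn_sq (hq : q ^ 2 < 1) (u : ℝ) : dn u q ^ 2 = 1 - q ^ 2 * sn u q ^ 2 :=
  Real.sq_sqrt (one_sub_sq_mul_sin_sq_pos hq _).le

theorem hasDerivAt_sn (hq : q ^ 2 < 1) (u : ℝ) :
    HasDerivAt (fun u => sn u q) (cn u q * dn u q) u :=
  (hasDerivAt_am hq u).sin

theorem hasDerivAt_cn (hq : q ^ 2 < 1) (u : ℝ) :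
    HasDerivAt (fun u => cn u q) (-(sn u q * dn u q)) u :=
  (hasDerivAt_am hq u).cos.congr_deriv (neg_mul _ _)

theorem hasDerivAt_dn (hq : q ^ 2 < 1) (u : ℝ) :
    HasDerivAt (fun u => dn u q) (-(q ^ 2 * sn u q * cn u q)) u := by
  refine ((((hasDerivAt_sn hq u).pow 2).const_mul (q ^ 2)).const_sub 1).sqrt
    (one_sub_sq_mul_sin_sq_pos hq _).ne' |>.congr_deriv ?_
  have hdn := (dn_pos hq u).ne'
  change _ / (2 * dn u q) = _
  field_simp
  norm_num
  ring

theorem hasDerivAt_jacobiEpsilon (hq : q ^ 2 < 1) (u : ℝ) :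
    HasDerivAt (fun u => jacobiEpsilon u q) (dn u q ^ 2) u := by
  have hcont : Continuous fun u => dn u q ^ 2 :=
    continuous_iff_continuousAt.2 fun u => ((hasDerivAt_dn hq u).pow 2).continuousAt
  exact intervalIntegral.integral_hasDerivAt_right (hcont.intervalIntegrable _ _)
    (hcont.stronglyMeasurableAtFilter _ _) hcont.continuousAt

theorem u₁_sq (hq : q ^ 2 < 1) (t : ℝ) :
    u₁ q t ^ 2 = sn t q ^ 2 * (1 - sn t q ^ 2) * (1 - q ^ 2 * sn t q ^ 2) := by
  rw [u₁, mul_pow, mul_pow, cn_sq, dn_sq hq]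

/-- Lamé's equation `u'' = (12 q² sn²(t, q) - 4 - 4 q²) u`, written as a first-order system for
`u` and its derivative `u'`. -/
structure IsLameSolution (q : ℝ) (u u' : ℝ → ℝ) : Prop where
  hasDerivAt_fst : ∀ t, HasDerivAt u (u' t) t
  hasDerivAt_snd : ∀ t, HasDerivAt u' ((12 * q ^ 2 * sn t q ^ 2 - 4 - 4 * q ^ 2) * u t) t

/-- The derivative of `u₁`, as a polynomial in `sn`. -/
noncomputable def u₁Deriv (q t : ℝ) : ℝ :=
  1 - 2 * (1 + q ^ 2) * sn t q ^ 2 + 3 * q ^ 2 * sn t q ^ 4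

/-- The derivative of `u₂`, grouped as in the definition of `u₂`. -/
noncomputable def u₂Deriv (q t : ℝ) : ℝ :=
  (-2 * ((-2 * q ^ 6 + 3 * q ^ 4 - 5 * q ^ 2 + 2)
      + 4 * q ^ 2 * (q ^ 4 - q ^ 2 + 1) * cn t q ^ 2)
    + ((-q ^ 4 + 3 * q ^ 2 - 2) + 2 * (q ^ 4 - q ^ 2 + 1) * dn t q ^ 2)) * u₁ q t
  + ((-q ^ 4 + 3 * q ^ 2 - 2) * t + 2 * (q ^ 4 - q ^ 2 + 1) * jacobiEpsilon t q) * u₁Deriv q t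

theorem hasDerivAt_u₁ (hq : q ^ 2 < 1) (t : ℝ) : HasDerivAt (u₁ q) (u₁Deriv q t) t := by
  refine (((hasDerivAt_sn hq t).mul (hasDerivAt_cn hq t)).mul
    (hasDerivAt_dn hq t)).congr_deriv ?_
  simp only [u₁Deriv, Pi.mul_apply]
  linear_combination (dn t q ^ 2 - q ^ 2 * sn t q ^ 2) * cn_sq t q
    + (1 - 2 * sn t q ^ 2) * dn_sq hq t

theorem isLameSolution_u₁ (hq : q ^ 2 < 1) : IsLameSolution q (u₁ q) (u₁Deriv q) where
  hasDerivAt_fst := hasDerivAt_u₁ hq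
  hasDerivAt_snd t := by
    have hsn := hasDerivAt_sn hq t
    refine ((((hsn.pow 2).const_mul (2 * (1 + q ^ 2))).const_sub 1).add
      ((hsn.pow 4).const_mul (3 * q ^ 2))).congr_deriv ?_
    simp only [u₁]
    push_cast
    ring

theorem hasDerivAt_u₂ (hq : q ^ 2 < 1) (t : ℝ) : HasDerivAt (u₂ q) (u₂Deriv q t) t := by
  have hcn := hasDerivAt_cn hq t
  have h_even := (((hcn.pow 2).const_mul (-2 * q ^ 6 + 3 * q ^ 4 - 5 * q ^ 2 + 2)).const_add
    (-1 + q ^ 2)).add ((hcn.pow 4).const_mul (2 * q ^ 2 * (q ^ 4 - q ^ 2 + 1)))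
  have h_secular := ((hasDerivAt_id t).const_mul (-q ^ 4 + 3 * q ^ 2 - 2)).add
    ((hasDerivAt_jacobiEpsilon hq t).const_mul (2 * (q ^ 4 - q ^ 2 + 1)))
  refine (h_even.add (h_secular.mul (hasDerivAt_u₁ hq t))).congr_deriv ?_
  simp only [u₂Deriv, u₁, Pi.add_apply, id]
  push_cast
  ring

theorem isLameSolution_u₂ (hq : q ^ 2 < 1) : IsLameSolution q (u₂ q) (u₂Deriv q) where
  hasDerivAt_fst := hasDerivAt_u₂ hq
  hasDerivAt_snd t := by
    have h_coeff := (((((hasDerivAt_cn hq t).pow 2).const_mul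
      (4 * q ^ 2 * (q ^ 4 - q ^ 2 + 1))).const_add
      (-2 * q ^ 6 + 3 * q ^ 4 - 5 * q ^ 2 + 2)).const_mul (-2)).add
      ((((hasDerivAt_dn hq t).pow 2).const_mul (2 * (q ^ 4 - q ^ 2 + 1))).const_add
        (-q ^ 4 + 3 * q ^ 2 - 2))
    have h_secular := ((hasDerivAt_id t).const_mul (-q ^ 4 + 3 * q ^ 2 - 2)).add
      ((hasDerivAt_jacobiEpsilon hq t).const_mul (2 * (q ^ 4 - q ^ 2 + 1)))
    refine ((h_coeff.mul (hasDerivAt_u₁ hq t)).add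
      (h_secular.mul ((isLameSolution_u₁ hq).hasDerivAt_snd t))).congr_deriv ?_
    have h_cn_pow_four : cn t q ^ 4 = (1 - sn t q ^ 2) ^ 2 := by rw [← cn_sq]; ring
    have h_u₁_sq := u₁_sq hq t
    rw [u₁] at h_u₁_sq
    simp only [u₂, u₁, u₁Deriv, Pi.add_apply, Pi.pow_apply, id]
    push_cast
    rw [h_cn_pow_four, cn_sq, dn_sq hq]
    linear_combination 12 * q ^ 2 * (q ^ 4 - q ^ 2 + 1) * h_u₁_sq

end Jacobi

/-! ### The unperturbed motion and its linearization -/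

section Unperturbed

variable {a c y η : ℝ}

theorem modulus_sq (hcb : c < -a - c) (hba : -a - c < a) :
    modulus a c ^ 2 = (2 * c + a) / (c - a) :=
  Real.sq_sqrt (div_nonneg_of_nonpos (by linarith) (by linarith))

theorem modulus_sq_lt_one (hcb : c < -a - c) (hba : -a - c < a) : modulus a c ^ 2 < 1 := by
  rw [modulus_sq hcb hba, div_lt_one_of_neg (by linarith)]
  linarith

/-- The closed form `c - (2c + a) sn²(√((a - c)/6) t + θ)` of the solutions of `x'' = x² - 𝓑`,
with an arbitrary phase `θ`. -/
noncomputable def snSolution (a c θ t : ℝ) : ℝ :=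
  c - (2 * c + a) * sn (√((a - c) / 6) * t + θ) (modulus a c) ^ 2

/-- The velocity of `snSolution`. -/
noncomputable def snVelocity (a c θ t : ℝ) : ℝ :=
  -2 * (2 * c + a) * √((a - c) / 6) * u₁ (modulus a c) (√((a - c) / 6) * t + θ)

theorem hasDerivAt_comp_mul_add {f : ℝ → ℝ} {f' r θ t : ℝ} (h : HasDerivAt f f' (r * t + θ)) :
    HasDerivAt (fun t => f (r * t + θ)) (r * f') t := by
  have h_affine : HasDerivAt (fun t : ℝ => r * t + θ) r t := by
    simpa using ((hasDerivAt_id t).const_mul r).add_const θ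
  exact (h.comp t h_affine).congr_deriv (mul_comm _ _)

theorem hasDerivAt_snSolution (hcb : c < -a - c) (hba : -a - c < a) (θ t : ℝ) :
    HasDerivAt (snSolution a c θ) (snVelocity a c θ t) t := by
  have h_sn := hasDerivAt_comp_mul_add
    (hasDerivAt_sn (modulus_sq_lt_one hcb hba) (√((a - c) / 6) * t + θ))
  refine (((h_sn.pow 2).const_mul (2 * c + a)).const_sub c).congr_deriv ?_
  simp only [snVelocity, u₁]
  push_cast
  ring

theorem hasDerivAt_snVelocity (hcb : c < -a - c) (hba : -a - c < a) (θ t : ℝ) :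
    HasDerivAt (snVelocity a c θ) (snSolution a c θ t ^ 2 - calB a c) t := by
  have h_u₁ := hasDerivAt_comp_mul_add
    (hasDerivAt_u₁ (modulus_sq_lt_one hcb hba) (√((a - c) / 6) * t + θ))
  refine (h_u₁.const_mul (-2 * (2 * c + a) * √((a - c) / 6))).congr_deriv ?_
  have h_freq : √((a - c) / 6) ^ 2 = (a - c) / 6 := Real.sq_sqrt (by linarith)
  have hca : c - a ≠ 0 := by linarith
  simp only [snSolution, u₁Deriv, calB]
  generalize sn (√((a - c) / 6) * t + θ) (modulus a c) = S
  rw [modulus_sq hcb hba]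
  generalize √((a - c) / 6) = r at h_freq
  field_simp
  linear_combination (-6 * (2 * c + a) * ((c - a) * (1 - 2 * S ^ 2) +
    (2 * c + a) * S ^ 2 * (3 * S ^ 2 - 2))) * h_freq

theorem sin_arcsin_sqrt_nonneg (p : ℝ) : 0 ≤ Real.sin (Real.arcsin √p) :=
  Real.sin_nonneg_of_nonneg_of_le_pi (Real.arcsin_nonneg.2 (Real.sqrt_nonneg _))
    ((Real.arcsin_le_pi_div_two _).trans (by linarith [Real.pi_pos]))

theorem am_phase_of_neg (hcb : c < -a - c) (hba : -a - c < a) (hη : η < 0) :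
    am (phase a c y η) (modulus a c) = -Real.arcsin √((c - y) / (2 * c + a)) := by
  rw [phase, if_pos hη, ← ellipticF_neg, am_ellipticF (modulus_sq_lt_one hcb hba)]

theorem am_phase_of_nonneg (hcb : c < -a - c) (hba : -a - c < a) (hη : 0 ≤ η) :
    am (phase a c y η) (modulus a c) = Real.arcsin √((c - y) / (2 * c + a)) := by
  rw [phase, if_neg hη.not_gt, am_ellipticF (modulus_sq_lt_one hcb hba)]

theorem sn_phase_sq (hcb : c < -a - c) (hba : -a - c < a) (hy : y ∈ Icc c (-a - c)) :
    sn (phase a c y η) (modulus a c) ^ 2 = (c - y) / (2 * c + a) := by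
  have h_nonneg : 0 ≤ (c - y) / (2 * c + a) :=
    div_nonneg_of_nonpos (by linarith [hy.1]) (by linarith)
  have h_le_one : (c - y) / (2 * c + a) ≤ 1 := by
    rw [div_le_one_of_neg (by linarith)]
    linarith [hy.2]
  have h_sin_sq : Real.sin (Real.arcsin √((c - y) / (2 * c + a))) ^ 2 =
      (c - y) / (2 * c + a) := by
    rw [Real.sin_arcsin (by linarith [Real.sqrt_nonneg ((c - y) / (2 * c + a))])
      (Real.sqrt_le_one.2 h_le_one), Real.sq_sqrt h_nonneg]
  rcases lt_or_ge η 0 with hη | hη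
  · rw [sn, am_phase_of_neg hcb hba hη, Real.sin_neg, neg_sq, h_sin_sq]
  · rw [sn, am_phase_of_nonneg hcb hba hη, h_sin_sq]

theorem snSolution_phase_zero (hcb : c < -a - c) (hba : -a - c < a) (hy : y ∈ Icc c (-a - c)) :
    snSolution a c (phase a c y η) 0 = y := by
  rw [snSolution, mul_zero, zero_add, sn_phase_sq hcb hba hy, mul_div_cancel₀ _ (by linarith),
    sub_sub_cancel]

theorem u₁_phase_nonpos (hcb : c < -a - c) (hba : -a - c < a) (hη : η < 0) :
    u₁ (modulus a c) (phase a c y η) ≤ 0 := by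
  refine mul_nonpos_of_nonpos_of_nonneg ?_ (Real.sqrt_nonneg _)
  rw [sn, cn, am_phase_of_neg hcb hba hη, Real.sin_neg, Real.cos_neg]
  exact mul_nonpos_of_nonpos_of_nonneg (neg_nonpos.2 (sin_arcsin_sqrt_nonneg _))
    (Real.cos_arcsin_nonneg _)

theorem u₁_phase_nonneg (hcb : c < -a - c) (hba : -a - c < a) (hη : 0 ≤ η) :
    0 ≤ u₁ (modulus a c) (phase a c y η) := by
  refine mul_nonneg ?_ (Real.sqrt_nonneg _)
  rw [sn, cn, am_phase_of_nonneg hcb hba hη]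
  exact mul_nonneg (sin_arcsin_sqrt_nonneg _) (Real.cos_arcsin_nonneg _)

theorem snVelocity_phase_zero_sq (hcb : c < -a - c) (hba : -a - c < a) (hy : y ∈ Icc c (-a - c))
    (hη : hamiltonian (calB a c) y η = a * c * (a + c) / 3) :
    snVelocity a c (phase a c y η) 0 ^ 2 = η ^ 2 := by
  have hca : c - a ≠ 0 := by linarith
  have hca' : 2 * c + a ≠ 0 := by linarith
  have h_freq : √((a - c) / 6) ^ 2 = (a - c) / 6 := Real.sq_sqrt (by linarith)
  have h_energy : η ^ 2 = 2 * (a * c * (a + c) / 3 + y ^ 3 / 3 - calB a c * y) := by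
    rw [hamiltonian] at hη
    linarith
  rw [snVelocity, mul_zero, zero_add, mul_pow, mul_pow, mul_pow, h_freq,
    u₁_sq (modulus_sq_lt_one hcb hba), sn_phase_sq hcb hba hy, modulus_sq hcb hba, h_energy, calB]
  field_simp
  ring

theorem snVelocity_phase_zero (hcb : c < -a - c) (hba : -a - c < a) (hy : y ∈ Icc c (-a - c))
    (hη : hamiltonian (calB a c) y η = a * c * (a + c) / 3) :
    snVelocity a c (phase a c y η) 0 = η := by
  have h_sq := snVelocity_phase_zero_sq hcb hba hy hη
  have h_amplitude : 0 ≤ -2 * (2 * c + a) * √((a - c) / 6) :=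
    mul_nonneg (by linarith) (Real.sqrt_nonneg _)
  have h_eval : snVelocity a c (phase a c y η) 0 =
      -2 * (2 * c + a) * √((a - c) / 6) * u₁ (modulus a c) (phase a c y η) := by
    rw [snVelocity, mul_zero, zero_add]
  rcases lt_or_ge η 0 with h_neg | h_nonneg
  · have h_nonpos : snVelocity a c (phase a c y η) 0 ≤ 0 :=
      h_eval ▸ mul_nonpos_of_nonneg_of_nonpos h_amplitude (u₁_phase_nonpos hcb hba h_neg)
    rw [← neg_inj, ← sq_eq_sq₀ (neg_nonneg.2 h_nonpos) (neg_nonneg.2 h_neg.le), neg_sq, neg_sq,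
      h_sq]
  · have h_nonneg' : 0 ≤ snVelocity a c (phase a c y η) 0 :=
      h_eval ▸ mul_nonneg h_amplitude (u₁_phase_nonneg hcb hba h_nonneg)
    rwa [← sq_eq_sq₀ h_nonneg' h_nonneg]

theorem isUnperturbedSolution_snSolution (hcb : c < -a - c) (hba : -a - c < a)
    (hy : y ∈ Icc c (-a - c)) (hη : hamiltonian (calB a c) y η = a * c * (a + c) / 3) :
    IsUnperturbedSolution (calB a c) y η (snSolution a c (phase a c y η)) :=
  ⟨snVelocity a c (phase a c y η), snSolution_phase_zero hcb hba hy,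
    snVelocity_phase_zero hcb hba hy hη,
    fun t _ => (hasDerivAt_snSolution hcb hba _ t).hasDerivWithinAt,
    fun t _ => (hasDerivAt_snVelocity hcb hba _ t).hasDerivWithinAt⟩

theorem eqOn_Ici_of_locallyLipschitz {E : Type*} [NormedAddCommGroup E] [NormedSpace ℝ E]
    {v : E → E} (hv : LocallyLipschitz v) {f g : ℝ → E} {t₀ : ℝ}
    (hf : ∀ t, t₀ ≤ t → HasDerivWithinAt f (v (f t)) (Ici t₀) t)
    (hg : ∀ t, t₀ ≤ t → HasDerivWithinAt g (v (g t)) (Ici t₀) t) (hfg : f t₀ = g t₀) :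
    EqOn f g (Ici t₀) := by
  intro T hT
  have hf_cont : ContinuousOn f (Icc t₀ T) := fun t ht =>
    (hf t ht.1).continuousWithinAt.mono Icc_subset_Ici_self
  have hg_cont : ContinuousOn g (Icc t₀ T) := fun t ht =>
    (hg t ht.1).continuousWithinAt.mono Icc_subset_Ici_self
  obtain ⟨K, hK⟩ := hv.locallyLipschitzOn.exists_lipschitzOnWith_of_compact
    ((isCompact_Icc.image_of_continuousOn hf_cont).union
      (isCompact_Icc.image_of_continuousOn hg_cont))
  exact ODE_solution_unique_of_mem_Icc_right (v := fun _ => v) (fun _ _ => hK)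
    hf_cont (fun t ht => (hf t ht.1).mono (Ici_subset_Ici.2 ht.1))
    (fun t ht => .inl (mem_image_of_mem f (Ico_subset_Icc_self ht)))
    hg_cont (fun t ht => (hg t ht.1).mono (Ici_subset_Ici.2 ht.1))
    (fun t ht => .inr (mem_image_of_mem g (Ico_subset_Icc_self ht))) hfg ⟨hT, le_rfl⟩

theorem IsUnperturbedSolution.eqOn {b : ℝ} {x z : ℝ → ℝ} (hx : IsUnperturbedSolution b y η x)
    (hz : IsUnperturbedSolution b y η z) : EqOn x z (Ici 0) := by
  obtain ⟨ξ, hx0, hξ0, hx', hξ'⟩ := hx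
  obtain ⟨ζ, hz0, hζ0, hz', hζ'⟩ := hz
  have h_field : LocallyLipschitz fun p : ℝ × ℝ => (p.2, p.1 ^ 2 - b) :=
    ContDiff.locallyLipschitz (𝕂 := ℝ) (by fun_prop)
  have h_eqOn : EqOn (fun t => (x t, ξ t)) (fun t => (z t, ζ t)) (Ici 0) :=
    eqOn_Ici_of_locallyLipschitz h_field (fun t ht => (hx' t ht).prodMk (hξ' t ht))
      (fun t ht => (hz' t ht).prodMk (hζ' t ht)) (by simp only [hx0, hz0, hξ0, hζ0])
  exact fun t ht => congrArg Prod.fst (h_eqOn ht)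

theorem IsUnperturbedSolution.continuousOn {b : ℝ} {x : ℝ → ℝ}
    (hx : IsUnperturbedSolution b y η x) : ContinuousOn x (Ici 0) := by
  obtain ⟨_, _, _, hx', _⟩ := hx
  exact fun t ht => (hx' t ht).continuousWithinAt

/-- The homogeneous linearized equation `w'' = 2 x₀ w` on `[0, ∞)`, written as a first-order
system for `w` and its derivative `w'`. -/
structure IsHomogeneousSolution (x₀ w w' : ℝ → ℝ) : Prop where
  hasDerivWithinAt_fst : ∀ t, 0 ≤ t → HasDerivWithinAt w (w' t) (Ici 0) t
  hasDerivWithinAt_snd : ∀ t, 0 ≤ t → HasDerivWithinAt w' (2 * x₀ t * w t) (Ici 0) t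

theorem freq_sq_mul_lame_potential (hcb : c < -a - c) (hba : -a - c < a) (θ t : ℝ) :
    √((a - c) / 6) ^ 2 * (12 * modulus a c ^ 2 * sn (√((a - c) / 6) * t + θ) (modulus a c) ^ 2
      - 4 - 4 * modulus a c ^ 2) = 2 * snSolution a c θ t := by
  rw [snSolution, modulus_sq hcb hba, Real.sq_sqrt (by linarith)]
  have hca : c - a ≠ 0 := by linarith
  field_simp
  ring

theorem IsLameSolution.isHomogeneousSolution (hcb : c < -a - c) (hba : -a - c < a)
    {u u' x₀ : ℝ → ℝ} (hu : IsLameSolution (modulus a c) u u') (k θ : ℝ)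
    (hx₀ : EqOn x₀ (snSolution a c θ) (Ici 0)) :
    IsHomogeneousSolution x₀ (fun t => k * u (√((a - c) / 6) * t + θ))
      (deriv fun t => k * u (√((a - c) / 6) * t + θ)) := by
  have h_fst (t : ℝ) : HasDerivAt (fun t => k * u (√((a - c) / 6) * t + θ))
      (k * (√((a - c) / 6) * u' (√((a - c) / 6) * t + θ))) t :=
    (hasDerivAt_comp_mul_add (hu.hasDerivAt_fst _)).const_mul k
  rw [funext fun t => (h_fst t).deriv]
  refine ⟨fun t _ => (h_fst t).hasDerivWithinAt, fun t ht => ?_⟩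
  refine ((((hasDerivAt_comp_mul_add (hu.hasDerivAt_snd _)).const_mul _).const_mul
    k).congr_deriv ?_).hasDerivWithinAt
  rw [hx₀ ht, ← freq_sq_mul_lame_potential hcb hba]
  ring

theorem IsUnperturbedSolution.isHomogeneousSolution_w₁ (hcb : c < -a - c) (hba : -a - c < a)
    (hy : y ∈ Icc c (-a - c)) (hη : hamiltonian (calB a c) y η = a * c * (a + c) / 3)
    {x₀ : ℝ → ℝ} (hx₀ : IsUnperturbedSolution (calB a c) y η x₀) (k : ℝ) :
    IsHomogeneousSolution x₀ (w₁ a c y η k) (deriv (w₁ a c y η k)) :=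
  (isLameSolution_u₁ (modulus_sq_lt_one hcb hba)).isHomogeneousSolution hcb hba k _
    (hx₀.eqOn (isUnperturbedSolution_snSolution hcb hba hy hη))

theorem IsUnperturbedSolution.isHomogeneousSolution_w₂ (hcb : c < -a - c) (hba : -a - c < a)
    (hy : y ∈ Icc c (-a - c)) (hη : hamiltonian (calB a c) y η = a * c * (a + c) / 3)
    {x₀ : ℝ → ℝ} (hx₀ : IsUnperturbedSolution (calB a c) y η x₀) (k : ℝ) :
    IsHomogeneousSolution x₀ (w₂ a c y η k) (deriv (w₂ a c y η k)) :=
  (isLameSolution_u₂ (modulus_sq_lt_one hcb hba)).isHomogeneousSolution hcb hba k _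
    (hx₀.eqOn (isUnperturbedSolution_snSolution hcb hba hy hη))

end Unperturbed

/-! ### Calculus on intervals and half-lines -/

section Calculus

variable {E : Type*} [NormedAddCommGroup E] {a : ℝ}

theorem intervalIntegrable_of_continuousOn_Icc {f : ℝ → E} {b c d : ℝ}
    (hf : ContinuousOn f (Icc c d)) (ha : a ∈ Icc c d) (hb : b ∈ Icc c d) :
    IntervalIntegrable f volume a b :=
  (hf.mono (uIcc_subset_Icc ha hb)).intervalIntegrable

theorem intervalIntegrable_of_continuousOn_Ici {f : ℝ → E} (hf : ContinuousOn f (Ici a)) {t : ℝ}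
    (ht : a ≤ t) : IntervalIntegrable f volume a t :=
  (hf.mono Icc_subset_Ici_self).intervalIntegrable_of_Icc ht

variable [NormedSpace ℝ E]

theorem eqOn_Ici_of_hasDerivWithinAt_eq {f g f' : ℝ → E}
    (hf : ∀ t, a ≤ t → HasDerivWithinAt f (f' t) (Ici a) t)
    (hg : ∀ t, a ≤ t → HasDerivWithinAt g (f' t) (Ici a) t) (hfg : f a = g a) :
    EqOn f g (Ici a) := fun t ht =>
  eq_of_has_deriv_right_eq (fun s hs => (hf s hs.1).mono (Ici_subset_Ici.2 hs.1))
    (fun s hs => (hg s hs.1).mono (Ici_subset_Ici.2 hs.1))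
    (fun s hs => (hf s hs.1).continuousWithinAt.mono Icc_subset_Ici_self)
    (fun s hs => (hg s hs.1).continuousWithinAt.mono Icc_subset_Ici_self) hfg t ⟨ht, le_rfl⟩

theorem continuousOn_parametric_primitive_Ici {f : ℝ → ℝ → E}
    (hf : ContinuousOn (Function.uncurry f) (Ici a ×ˢ Ici a)) :
    ContinuousOn (fun t => ∫ s in a..t, f t s) (Ici a) := by
  have h_extend : Continuous fun p : ℝ × ℝ => f (max p.1 a) (max p.2 a) :=
    hf.comp_continuous (f := fun p : ℝ × ℝ => (max p.1 a, max p.2 a)) (by fun_prop) fun p =>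
      ⟨le_max_right p.1 a, le_max_right p.2 a⟩
  have h_integral : Continuous fun t => ∫ s in a..t, f (max t a) (max s a) :=
    intervalIntegral.continuous_parametric_intervalIntegral_of_continuous (μ := volume)
      (f := fun t s => f (max t a) (max s a)) h_extend continuous_id
  refine h_integral.continuousOn.congr fun t ht => ?_
  refine intervalIntegral.integral_congr fun s hs => ?_
  rw [uIcc_of_le ht] at hs
  simp only [max_eq_left (mem_Ici.1 ht), max_eq_left hs.1]

theorem hasDerivWithinAt_primitive_Ici [CompleteSpace E] {f : ℝ → E} (hf : ContinuousOn f (Ici a))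
    {t : ℝ} (ht : a ≤ t) :
    HasDerivWithinAt (fun t => ∫ s in a..t, f s) (f t) (Ici a) t := by
  have h_extend : Continuous fun s => f (max s a) :=
    hf.comp_continuous (by fun_prop) fun s => le_max_right s a
  have h_primitive := (intervalIntegral.integral_hasDerivAt_right
    (h_extend.intervalIntegrable a t) (h_extend.stronglyMeasurableAtFilter _ _)
    h_extend.continuousAt).hasDerivWithinAt (s := Ici a)
  have h_eqOn : EqOn (fun t => ∫ s in a..t, f s) (fun t => ∫ s in a..t, f (max s a)) (Ici a) := by
    intro t ht
    refine intervalIntegral.integral_congr fun s hs => ?_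
    rw [uIcc_of_le ht] at hs
    simp only [max_eq_left hs.1]
  simpa only [max_eq_left ht] using h_primitive.congr h_eqOn (h_eqOn ht)

theorem continuousOn_primitive_Ici [CompleteSpace E] {f : ℝ → E} (hf : ContinuousOn f (Ici a)) :
    ContinuousOn (fun t => ∫ s in a..t, f s) (Ici a) := fun _ ht =>
  (hasDerivWithinAt_primitive_Ici hf ht).continuousWithinAt

end Calculus

/-! ### Variation of constants -/

section Pathwise

variable {x₀ F x ξ f w w' v₁ v₁' v₂ v₂' : ℝ → ℝ}

/-- The integral `∫₀ᵗ w dF` of a differentiable function `w` with derivative `w'` against a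
continuous path `F` with `F 0 = 0`, defined through integration by parts. -/
noncomputable def pathIntegral (w w' F : ℝ → ℝ) (t : ℝ) : ℝ :=
  w t * F t - ∫ s in (0 : ℝ)..t, w' s * F s

theorem SolvesLinearized.continuousOn (h : SolvesLinearized x₀ F x) :
    ContinuousOn x (Ici 0) := by
  obtain ⟨ξ, hξ, hx, -⟩ := h
  exact (continuousOn_primitive_Ici hξ).congr hx

theorem IsHomogeneousSolution.continuousOn_fst (hw : IsHomogeneousSolution x₀ w w') :
    ContinuousOn w (Ici 0) :=
  fun t ht => (hw.hasDerivWithinAt_fst t ht).continuousWithinAt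

theorem IsHomogeneousSolution.continuousOn_snd (hw : IsHomogeneousSolution x₀ w w') :
    ContinuousOn w' (Ici 0) :=
  fun t ht => (hw.hasDerivWithinAt_snd t ht).continuousWithinAt

theorem IsHomogeneousSolution.wronskian_eq_pathIntegral (hx₀ : ContinuousOn x₀ (Ici 0))
    (hF : ContinuousOn F (Ici 0)) (hw : IsHomogeneousSolution x₀ w w')
    (hξ : ContinuousOn ξ (Ici 0)) (hx : ∀ t, 0 ≤ t → x t = ∫ s in (0 : ℝ)..t, ξ s)
    (hξF : ∀ t, 0 ≤ t → ξ t = (∫ s in (0 : ℝ)..t, 2 * x₀ s * x s) + F t) {t : ℝ} (ht : 0 ≤ t) :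
    w t * ξ t - w' t * x t = pathIntegral w w' F t := by
  have hx' (t : ℝ) (ht : 0 ≤ t) : HasDerivWithinAt x (ξ t) (Ici 0) t :=
    (hasDerivWithinAt_primitive_Ici hξ ht).congr hx (hx t ht)
  have hx_cont : ContinuousOn x (Ici 0) := fun t ht => (hx' t ht).continuousWithinAt
  have hx_zero : x 0 = 0 := by rw [hx 0 le_rfl, intervalIntegral.integral_same]
  -- `F` has no derivative, so it is subtracted from `ξ` before differentiating the Wronskian.
  have h_regular_part (t : ℝ) (ht : 0 ≤ t) : HasDerivWithinAt
      (fun t => w t * (∫ s in (0 : ℝ)..t, 2 * x₀ s * x s) - w' t * x t)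
      (-(w' t * F t)) (Ici 0) t := by
    refine (((hw.hasDerivWithinAt_fst t ht).mul
      (hasDerivWithinAt_primitive_Ici (by fun_prop) ht)).sub
      ((hw.hasDerivWithinAt_snd t ht).mul (hx' t ht))).congr_deriv ?_
    linear_combination (-w' t) * hξF t ht
  have h_integrated : w t * (∫ s in (0 : ℝ)..t, 2 * x₀ s * x s) - w' t * x t =
      -∫ s in (0 : ℝ)..t, w' s * F s :=
    eqOn_Ici_of_hasDerivWithinAt_eq h_regular_part
      (fun t ht => (hasDerivWithinAt_primitive_Ici (hw.continuousOn_snd.mul hF) ht).neg)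
      (by simp [hx_zero]) ht
  rw [pathIntegral, hξF t ht]
  linear_combination h_integrated

theorem SolvesLinearized.eq_pathIntegral (hx₀ : ContinuousOn x₀ (Ici 0))
    (hF : ContinuousOn F (Ici 0)) (hv₁ : IsHomogeneousSolution x₀ v₁ v₁')
    (hv₂ : IsHomogeneousSolution x₀ v₂ v₂') (hW : ∀ t, 0 ≤ t → v₁ t * v₂' t - v₁' t * v₂ t = 1)
    (h : SolvesLinearized x₀ F x) {t : ℝ} (ht : 0 ≤ t) :
    x t = v₂ t * pathIntegral v₁ v₁' F t - v₁ t * pathIntegral v₂ v₂' F t := by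
  obtain ⟨ξ, hξ, hx, hξF⟩ := h
  rw [← hv₁.wronskian_eq_pathIntegral hx₀ hF hξ hx hξF ht,
    ← hv₂.wronskian_eq_pathIntegral hx₀ hF hξ hx hξF ht]
  linear_combination (-x t) * hW t ht

theorem pathIntegral_primitive (hw : ∀ t, 0 ≤ t → HasDerivWithinAt w (w' t) (Ici 0) t)
    (hw' : ContinuousOn w' (Ici 0)) (hf : ContinuousOn f (Ici 0)) {t : ℝ} (ht : 0 ≤ t) :
    pathIntegral w w' (fun t => ∫ s in (0 : ℝ)..t, f s) t = ∫ s in (0 : ℝ)..t, w s * f s := by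
  have hw_cont : ContinuousOn w (Ici 0) := fun t ht => (hw t ht).continuousWithinAt
  refine eqOn_Ici_of_hasDerivWithinAt_eq (f' := fun t => w t * f t) (fun t ht => ?_)
    (fun t ht => hasDerivWithinAt_primitive_Ici (hw_cont.mul hf) ht)
    (by simp [pathIntegral]) ht
  refine (((hw t ht).mul (hasDerivWithinAt_primitive_Ici hf ht)).sub
    (hasDerivWithinAt_primitive_Ici (hw'.mul (continuousOn_primitive_Ici hf)) ht)).congr_deriv ?_
  exact add_sub_cancel_left _ _

theorem SolvesLinearized.eq_integral_kernel (hx₀ : ContinuousOn x₀ (Ici 0))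
    (hf : ContinuousOn f (Ici 0)) (hv₁ : IsHomogeneousSolution x₀ v₁ v₁')
    (hv₂ : IsHomogeneousSolution x₀ v₂ v₂') (hW : ∀ t, 0 ≤ t → v₁ t * v₂' t - v₁' t * v₂ t = 1)
    (h : SolvesLinearized x₀ (fun t => ∫ s in (0 : ℝ)..t, f s) x) {t : ℝ} (ht : 0 ≤ t) :
    x t = ∫ s in (0 : ℝ)..t, kernel v₁ v₂ t s * f s := by
  have h_integrable {v : ℝ → ℝ} (hv : ContinuousOn v (Ici 0)) (r : ℝ) :
      IntervalIntegrable (fun s => r * (v s * f s)) volume 0 t :=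
    intervalIntegrable_of_continuousOn_Ici (continuousOn_const.mul (hv.mul hf)) ht
  rw [h.eq_pathIntegral hx₀ (continuousOn_primitive_Ici hf) hv₁ hv₂ hW ht,
    pathIntegral_primitive hv₁.hasDerivWithinAt_fst hv₁.continuousOn_snd hf ht,
    pathIntegral_primitive hv₂.hasDerivWithinAt_fst hv₂.continuousOn_snd hf ht,
    ← intervalIntegral.integral_const_mul, ← intervalIntegral.integral_const_mul,
    ← intervalIntegral.integral_sub (h_integrable hv₁.continuousOn_fst _)
      (h_integrable hv₂.continuousOn_fst _)]
  exact intervalIntegral.integral_congr fun s _ => by simp only [kernel]; ring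

theorem continuousOn_sum_convolution {z : ℕ → ℝ → ℝ} {s : Set ℝ} {n : ℕ}
    (hz : ∀ j, 1 ≤ j → j < n → ContinuousOn (z j) s) :
    ContinuousOn (fun t => ∑ j ∈ Finset.Ico 1 n, z j t * z (n - j) t) s := by
  refine continuousOn_finsetSum _ fun j hj => ?_
  rw [Finset.mem_Ico] at hj
  exact (hz j hj.1 hj.2).mul (hz (n - j) (by lia) (by lia))

theorem continuousOn_uncurry_kernel {s : Set ℝ} (h₁ : ContinuousOn v₁ s)
    (h₂ : ContinuousOn v₂ s) :
    ContinuousOn (Function.uncurry (kernel v₁ v₂)) (s ×ˢ s) := by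
  have h_fst {v : ℝ → ℝ} (hv : ContinuousOn v s) : ContinuousOn (fun p : ℝ × ℝ => v p.1) (s ×ˢ s) :=
    hv.comp continuousOn_fst fun _ hp => hp.1
  have h_snd {v : ℝ → ℝ} (hv : ContinuousOn v s) : ContinuousOn (fun p : ℝ × ℝ => v p.2) (s ×ˢ s) :=
    hv.comp continuousOn_snd fun _ hp => hp.2
  exact ((h_fst h₂).mul (h_snd h₁)).sub ((h_fst h₁).mul (h_snd h₂))

theorem continuousOn_gammaSeq (h₁ : ContinuousOn v₁ (Ici 0)) (h₂ : ContinuousOn v₂ (Ici 0))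
    {n : ℕ} (hn : 1 ≤ n) : ContinuousOn (gammaSeq v₁ v₂ n) (Ici 0) := by
  induction n using Nat.strong_induction_on with
  | _ n ih =>
    rcases hn.eq_or_lt with rfl | hn
    · rw [gammaSeq]
      exact h₁.abs.add h₂.abs
    · rw [funext fun t => gammaSeq_of_two_le v₁ v₂ n hn t]
      have h_sum := continuousOn_sum_convolution fun j hj hjn => ih j hjn hj
      exact continuousOn_parametric_primitive_Ici
        ((continuousOn_uncurry_kernel h₁ h₂).abs.mul (h_sum.comp continuousOn_snd fun _ hp => hp.2))

theorem abs_sum_convolution_le {z γ : ℕ → ℝ} {σ : ℝ} {n : ℕ}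
    (h : ∀ j, 1 ≤ j → j < n → |z j| ≤ γ j / σ ^ j) :
    |∑ j ∈ Finset.Ico 1 n, z j * z (n - j)| ≤
      (∑ j ∈ Finset.Ico 1 n, γ j * γ (n - j)) / σ ^ n := by
  rw [Finset.sum_div]
  refine (Finset.abs_sum_le_sum_abs _ _).trans (Finset.sum_le_sum fun j hj => ?_)
  rw [Finset.mem_Ico] at hj
  have h_left := h j hj.1 hj.2
  have h_right := h (n - j) (by lia) (by lia)
  calc |z j * z (n - j)| = |z j| * |z (n - j)| := abs_mul _ _
    _ ≤ γ j / σ ^ j * (γ (n - j) / σ ^ (n - j)) :=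
      mul_le_mul h_left h_right (abs_nonneg _) ((abs_nonneg _).trans h_left)
    _ = γ j * γ (n - j) / σ ^ n := by
      rw [div_mul_div_comm, ← pow_add, Nat.add_sub_cancel' hj.2.le]

theorem abs_le_gammaSeq_div {z : ℕ → ℝ → ℝ} (h₁ : ContinuousOn v₁ (Ici 0))
    (h₂ : ContinuousOn v₂ (Ici 0)) (hz : ∀ n, 1 ≤ n → ContinuousOn (z n) (Ici 0))
    (hrec : ∀ n, 2 ≤ n → ∀ t, 0 ≤ t → z n t = ∫ s in (0 : ℝ)..t, kernel v₁ v₂ t s *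
      ∑ j ∈ Finset.Ico 1 n, z j s * z (n - j) s) {T σ : ℝ}
    (hone : ∀ t ∈ Icc 0 T, |z 1 t| ≤ gammaSeq v₁ v₂ 1 t / σ) {n : ℕ} (hn : 1 ≤ n) :
    ∀ t ∈ Icc 0 T, |z n t| ≤ gammaSeq v₁ v₂ n t / σ ^ n := by
  induction n using Nat.strong_induction_on with
  | _ n ih =>
    rcases hn.eq_or_lt with rfl | hn
    · simpa only [pow_one] using hone
    intro t ht
    have h_kernel : ContinuousOn (kernel v₁ v₂ t) (Ici 0) :=
      (continuousOn_uncurry_kernel h₁ h₂).uncurry_left t ht.1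
    have h_source := continuousOn_sum_convolution (n := n) fun j hj _ => hz j hj
    have h_gamma := continuousOn_sum_convolution (n := n) fun j hj _ =>
      continuousOn_gammaSeq h₁ h₂ hj
    rw [hrec n hn t ht.1, gammaSeq_of_two_le v₁ v₂ n hn t, ← intervalIntegral.integral_div]
    refine (intervalIntegral.abs_integral_le_integral_abs ht.1).trans ?_
    refine intervalIntegral.integral_mono_on ht.1
      (intervalIntegrable_of_continuousOn_Ici (h_kernel.mul h_source).abs ht.1)
      (intervalIntegrable_of_continuousOn_Ici ((h_kernel.abs.mul h_gamma).div_const _) ht.1)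
      fun s hs => ?_
    rw [abs_mul, mul_div_assoc]
    exact mul_le_mul_of_nonneg_left (abs_sum_convolution_le fun j hj hjn =>
      ih j hjn hj s ⟨hs.1, hs.2.trans ht.2⟩) (abs_nonneg _)

end Pathwise

/-! ### Maximal inequalities for sums of independent random variables -/

theorem integral_abs_gaussianReal (v : ℝ≥0) :
    ∫ x, |x| ∂gaussianReal 0 v = √(2 / π) * √v := by
  rcases eq_or_ne v 0 with rfl | hv
  · simp
  have hv_pos : (0 : ℝ) < v := by positivity
  have h_density (x : ℝ) : gaussianPDFReal 0 v x • |x| =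
      (√(2 * π * v))⁻¹ * (|x| ^ (1 : ℝ) * Real.exp (-(1 / (2 * v)) * |x| ^ (2 : ℝ))) := by
    simp only [gaussianPDFReal, smul_eq_mul, Real.rpow_one, Real.rpow_two, sq_abs, sub_zero]
    rw [show -(1 / (2 * (v : ℝ))) * x ^ 2 = -x ^ 2 / (2 * v) by ring]
    ring
  have h_half_moment :
      ∫ r in Ioi (0 : ℝ), r ^ (1 : ℝ) * Real.exp (-(1 / (2 * v)) * r ^ (2 : ℝ)) = v := by
    rw [integral_rpow_mul_exp_neg_mul_rpow (by norm_num) (by norm_num) (by positivity),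
      show (-(1 + 1) / 2 : ℝ) = -1 by norm_num, show ((1 + 1) / 2 : ℝ) = 1 by norm_num,
      Real.Gamma_one, Real.rpow_neg_one]
    field_simp
  have h_const : (√(2 * π * v))⁻¹ * v = √v / (√2 * √π) := by
    rw [Real.sqrt_mul (by positivity), Real.sqrt_mul (by positivity)]
    field_simp
    exact (Real.sq_sqrt hv_pos.le).symm
  calc ∫ x, |x| ∂gaussianReal 0 v
      = ∫ x : ℝ, (√(2 * π * v))⁻¹ *
          (|x| ^ (1 : ℝ) * Real.exp (-(1 / (2 * v)) * |x| ^ (2 : ℝ))) := by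
        simp only [integral_gaussianReal_eq_integral_smul hv, h_density]
    _ = (√(2 * π * v))⁻¹ * (2 * v) := by
        rw [integral_const_mul, integral_comp_abs
          (f := fun r : ℝ => r ^ (1 : ℝ) * Real.exp (-(1 / (2 * v)) * r ^ (2 : ℝ))), h_half_moment]
    _ = 2 * (√v / (√2 * √π)) := by rw [mul_left_comm, h_const]
    _ = √(2 / π) * √v := by
        rw [Real.sqrt_div zero_le_two]
        field_simp
        exact (Real.sq_sqrt zero_le_two).symm

section Doob

variable {Ω : Type*} {mΩ : MeasurableSpace Ω} {μ : Measure Ω}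

theorem mul_measure_exists_le_abs_martingale_le [IsFiniteMeasure μ] {𝓕 : Filtration ℕ mΩ}
    {M : ℕ → Ω → ℝ} (hM : Martingale M 𝓕 μ) (ε : ℝ≥0) (N : ℕ) :
    ε * μ {ω | ∃ k ≤ N, ε ≤ |M k ω|} ≤ ENNReal.ofReal (∫ ω, |M N ω| ∂μ) := by
  have h_abs : M ⊔ -M = fun n ω => |M n ω| := rfl
  have h_sub : Submartingale (fun n ω => |M n ω|) 𝓕 μ :=
    h_abs ▸ hM.submartingale.sup hM.neg.submartingale
  have h_max := maximal_ineq h_sub (fun _ _ => abs_nonneg _) (ε := ε) N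
  refine (mul_le_mul_right (measure_mono ?_) _).trans (h_max.trans (ENNReal.ofReal_le_ofReal ?_))
  · rintro ω ⟨k, hk, hle⟩
    exact (Finset.le_sup'_iff (f := fun k => |M k ω|) _).2
      ⟨k, Finset.mem_range_succ_iff.2 hk, hle⟩
  · exact setIntegral_le_integral (h_sub.integrable N) (.of_forall fun _ => abs_nonneg _)

variable [IsProbabilityMeasure μ] {Y : ℕ → Ω → ℝ}

theorem martingale_sum_range_succ (hm : ∀ i, StronglyMeasurable (Y i)) (hY : iIndepFun Y μ)
    (hi : ∀ i, Integrable (Y i) μ) (h0 : ∀ i, ∫ ω, Y i ω ∂μ = 0) :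
    Martingale (fun n => ∑ j ∈ Finset.range (n + 1), Y j) (Filtration.natural Y hm) μ := by
  refine martingale_of_condExp_sub_eq_zero_nat (fun n => ?_) (fun n => ?_) fun n => ?_
  · refine Finset.stronglyMeasurable_sum _ fun j hj => ?_
    exact (Filtration.stronglyAdapted_natural hm j).mono
      ((Filtration.natural Y hm).mono (Finset.mem_range_succ_iff.1 hj))
  · exact integrable_finsetSum' _ fun j _ => hi j
  · rw [Finset.sum_range_succ _ (n + 1), add_sub_cancel_left]
    refine (hY.condExp_natural_ae_eq_of_lt hm n.lt_succ_self).trans (.of_forall fun _ => ?_)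
    exact h0 (n + 1)

theorem mul_measure_exists_le_abs_sum_le_of_stronglyMeasurable
    (hm : ∀ i, StronglyMeasurable (Y i)) (hY : iIndepFun Y μ) (hi : ∀ i, Integrable (Y i) μ)
    (h0 : ∀ i, ∫ ω, Y i ω ∂μ = 0) (ε : ℝ≥0) (N : ℕ) :
    ε * μ {ω | ∃ k ≤ N, ε ≤ |∑ j ∈ Finset.range k, Y j ω|} ≤
      ENNReal.ofReal (∫ ω, |∑ j ∈ Finset.range N, Y j ω| ∂μ) := by
  rcases eq_zero_or_pos ε with rfl | hε
  · simp
  have h_not_zero (ω : Ω) : ¬(ε : ℝ) ≤ |∑ j ∈ Finset.range 0, Y j ω| := by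
    simpa using hε
  rcases N with _ | N
  · have h_empty : {ω | ∃ k ≤ 0, ε ≤ |∑ j ∈ Finset.range k, Y j ω|} = ∅ := by
      refine eq_empty_of_forall_notMem ?_
      rintro ω ⟨k, hk, hle⟩
      exact h_not_zero ω (Nat.le_zero.1 hk ▸ hle)
    rw [h_empty, measure_empty, mul_zero]
    exact zero_le
  · have h_doob := mul_measure_exists_le_abs_martingale_le
      (martingale_sum_range_succ hm hY hi h0) ε N
    simp only [Finset.sum_apply] at h_doob
    refine (mul_le_mul_right (measure_mono ?_) _).trans h_doob
    rintro ω ⟨_ | k, hk, hle⟩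
    · exact absurd hle (h_not_zero ω)
    · exact ⟨k, Nat.succ_le_succ_iff.1 hk, hle⟩

theorem mul_measure_exists_le_abs_sum_le (hY : iIndepFun Y μ) (hi : ∀ i, Integrable (Y i) μ)
    (h0 : ∀ i, ∫ ω, Y i ω ∂μ = 0) (ε : ℝ≥0) (N : ℕ) :
    ε * μ {ω | ∃ k ≤ N, ε ≤ |∑ j ∈ Finset.range k, Y j ω|} ≤
      ENNReal.ofReal (∫ ω, |∑ j ∈ Finset.range N, Y j ω| ∂μ) := by
  have h_mk (i : ℕ) : Y i =ᵐ[μ] (hi i).1.mk (Y i) := (hi i).1.ae_eq_mk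
  have h_all : ∀ᵐ ω ∂μ, ∀ i, Y i ω = (hi i).1.mk (Y i) ω := ae_all_iff.2 h_mk
  have h_set : {ω | ∃ k ≤ N, (ε : ℝ) ≤ |∑ j ∈ Finset.range k, Y j ω|} =ᵐ[μ]
      {ω | ∃ k ≤ N, (ε : ℝ) ≤ |∑ j ∈ Finset.range k, (hi j).1.mk (Y j) ω|} := by
    refine Filter.eventuallyEq_set.2 (h_all.mono fun ω hω => ?_)
    simp only [mem_ofPred_eq, hω]
  have h_integral : ∫ ω, |∑ j ∈ Finset.range N, Y j ω| ∂μ =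
      ∫ ω, |∑ j ∈ Finset.range N, (hi j).1.mk (Y j) ω| ∂μ :=
    integral_congr_ae (h_all.mono fun ω hω => by simp only [hω])
  rw [measure_congr h_set, h_integral]
  exact mul_measure_exists_le_abs_sum_le_of_stronglyMeasurable
    (fun i => (hi i).1.stronglyMeasurable_mk) (hY.congr h_mk) (fun i => (hi i).congr (h_mk i))
    (fun i => (integral_congr_ae (h_mk i)).symm.trans (h0 i)) ε N

theorem hasLaw_sum_gaussianReal {v : ℕ → ℝ≥0} (hY : iIndepFun Y μ)
    (hl : ∀ i, HasLaw (Y i) (gaussianReal 0 (v i)) μ) (N : ℕ) :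
    HasLaw (∑ j ∈ Finset.range N, Y j) (gaussianReal 0 (∑ j ∈ Finset.range N, v j)) μ := by
  induction N with
  | zero =>
    rw [Finset.range_zero, Finset.sum_empty, Finset.sum_empty, gaussianReal_zero_var]
    exact ⟨aemeasurable_const, (Measure.map_const μ 0).trans (by simp)⟩
  | succ N ih =>
    rw [Finset.sum_range_succ, Finset.sum_range_succ]
    refine ⟨ih.aemeasurable.add (hl N).aemeasurable, ?_⟩
    simpa only [add_zero] using gaussianReal_add_gaussianReal_of_indepFun
      (hY.indepFun_finsetSum_of_notMem₀ (fun i => (hl i).aemeasurable)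
        (Finset.notMem_range_self (n := N))) ih.map_eq (hl N).map_eq

theorem measureReal_exists_le_abs_sum_gaussian_le {v : ℕ → ℝ≥0} (hY : iIndepFun Y μ)
    (hl : ∀ i, HasLaw (Y i) (gaussianReal 0 (v i)) μ) {ε : ℝ} (hε : 0 < ε) (N : ℕ) :
    μ.real {ω | ∃ k ≤ N, ε ≤ |∑ j ∈ Finset.range k, Y j ω|} ≤
      √(2 / π) * √(∑ j ∈ Finset.range N, (v j : ℝ)) / ε := by
  lift ε to ℝ≥0 using hε.le
  have h_centred (i : ℕ) : ∫ ω, Y i ω ∂μ = 0 := by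
    rw [(hl i).integral_eq, integral_id_gaussianReal]
  have h_abs_moment : ∫ ω, |∑ j ∈ Finset.range N, Y j ω| ∂μ =
      √(2 / π) * √(∑ j ∈ Finset.range N, (v j : ℝ)) := by
    have h := (hasLaw_sum_gaussianReal hY hl N).integral_comp (f := fun x : ℝ => |x|)
      (by fun_prop)
    simp only [Function.comp_def, Finset.sum_apply] at h
    rw [h, integral_abs_gaussianReal, NNReal.coe_sum]
  have h_doob := mul_measure_exists_le_abs_sum_le hY (fun i => (hl i).hasGaussianLaw.integrable)
    h_centred ε N
  rw [h_abs_moment] at h_doob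
  rw [le_div_iff₀' hε]
  simpa only [ENNReal.toReal_mul, ENNReal.coe_toReal, Measure.real] using
    ENNReal.toReal_le_of_le_ofReal (by positivity) h_doob

end Doob

section Fatou

variable {Ω : Type*} {mΩ : MeasurableSpace Ω} {μ : Measure Ω} {s : Set Ω} {A : ℕ → Set Ω}

theorem measure_le_liminf_measure
    (hs : ∀ᵐ ω ∂μ, ω ∈ s → ∀ᶠ N in Filter.atTop, ω ∈ A N) :
    μ s ≤ Filter.liminf (fun N => μ (A N)) Filter.atTop := by
  have h_mono : Monotone fun m => ⋂ N ≥ m, A N := fun i j hij =>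
    biInter_subset_biInter_left fun N hN => hij.trans hN
  have h_subset : μ s ≤ μ (⋃ m, ⋂ N ≥ m, A N) :=
    measure_mono_ae (hs.mono fun ω hω hωs =>
      let ⟨m, hm⟩ := Filter.eventually_atTop.1 (hω hωs)
      mem_iUnion.2 ⟨m, mem_iInter₂.2 hm⟩)
  rw [Filter.liminf_eq_iSup_iInf_of_nat]
  calc μ s ≤ ⨆ m, μ (⋂ N ≥ m, A N) := h_subset.trans_eq h_mono.measure_iUnion
    _ ≤ ⨆ m, ⨅ N ≥ m, μ (A N) :=
      iSup_mono fun m => le_iInf₂ fun N hN => measure_mono (biInter_subset_of_mem hN)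

theorem measureReal_le_of_tendsto [IsFiniteMeasure μ] {p : ℕ → ℝ} {l : ℝ}
    (hs : ∀ᵐ ω ∂μ, ω ∈ s → ∀ᶠ N in Filter.atTop, ω ∈ A N) (hA : ∀ N, μ.real (A N) ≤ p N)
    (hp : Filter.Tendsto p Filter.atTop (nhds l)) : μ.real s ≤ l := by
  have hl : 0 ≤ l := ge_of_tendsto' hp fun N => measureReal_nonneg.trans (hA N)
  refine ENNReal.toReal_le_of_le_ofReal hl ?_
  calc μ s ≤ Filter.liminf (fun N => μ (A N)) Filter.atTop := measure_le_liminf_measure hs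
    _ ≤ Filter.liminf (fun N => ENNReal.ofReal (p N)) Filter.atTop :=
      Filter.liminf_le_liminf (.of_forall fun N =>
        (ofReal_measureReal (μ := μ)).symm.trans_le (ENNReal.ofReal_le_ofReal (hA N)))
    _ = ENNReal.ofReal l := (ENNReal.tendsto_ofReal hp).liminf_eq

end Fatou

/-! ### Riemann sums along uniform partitions -/

section Riemann

variable {w w' F g : ℝ → ℝ} {T : ℝ}

/-- The `k`-th point of the uniform partition of `[0, T]` into `N` intervals. -/
noncomputable def grid (T : ℝ) (N k : ℕ) : ℝ := k / N * T

theorem grid_zero (T : ℝ) (N : ℕ) : grid T N 0 = 0 := by simp [grid]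

theorem grid_self (T : ℝ) {N : ℕ} (hN : N ≠ 0) : grid T N N = T := by
  rw [grid, div_self (Nat.cast_ne_zero.2 hN), one_mul]

theorem grid_succ_sub (T : ℝ) (N k : ℕ) : grid T N (k + 1) - grid T N k = T / N := by
  simp only [grid]
  push_cast
  ring

theorem grid_mono (hT : 0 ≤ T) (N : ℕ) : Monotone (grid T N) := fun i j hij => by
  unfold grid
  gcongr

theorem grid_nonneg (hT : 0 ≤ T) (N k : ℕ) : 0 ≤ grid T N k := by
  unfold grid
  positivity

theorem grid_mem_Icc (hT : 0 ≤ T) {N k : ℕ} (hk : k ≤ N) : grid T N k ∈ Icc 0 T :=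
  ⟨grid_nonneg hT N k, mul_le_of_le_one_left hT
    (div_le_one_of_le₀ (Nat.cast_le.2 hk) N.cast_nonneg)⟩

theorem uIcc_grid_subset (hT : 0 ≤ T) {N k : ℕ} (hk : k < N) :
    uIcc (grid T N k) (grid T N (k + 1)) ⊆ Icc 0 T :=
  uIcc_subset_Icc (grid_mem_Icc hT hk.le) (grid_mem_Icc hT hk)

theorem tendsto_grid_floor {t : ℝ} (ht : t ∈ Icc 0 T) :
    Filter.Tendsto (fun N : ℕ => grid T N ⌊t / T * N⌋₊) Filter.atTop (nhds t) := by
  have hT : 0 ≤ T := ht.1.trans ht.2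
  have h := ((tendsto_nat_floor_mul_div_atTop (div_nonneg ht.1 hT)).comp
    (tendsto_natCast_atTop_atTop (R := ℝ))).mul_const T
  rwa [div_mul_cancel_of_imp fun h => le_antisymm (h ▸ ht.2) ht.1] at h

theorem floor_div_mul_le {t : ℝ} (ht : t ∈ Icc 0 T) (N : ℕ) : ⌊t / T * N⌋₊ ≤ N :=
  Nat.floor_le_of_le (mul_le_of_le_one_left N.cast_nonneg
    (div_le_one_of_le₀ ht.2 (ht.1.trans ht.2)))

theorem eventually_grid_oscillation_le (hg : ContinuousOn g (Icc 0 T)) (hT : 0 ≤ T) {ε : ℝ}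
    (hε : 0 < ε) :
    ∀ᶠ N : ℕ in Filter.atTop, ∀ k < N, ∀ s ∈ uIcc (grid T N k) (grid T N (k + 1)),
      ∀ r ∈ uIcc (grid T N k) (grid T N (k + 1)), |g s - g r| ≤ ε := by
  obtain ⟨δ, hδ, h_modulus⟩ := Metric.uniformContinuousOn_iff.1
    (isCompact_Icc.uniformContinuousOn_of_continuous hg) ε hε
  filter_upwards [(tendsto_const_div_atTop_nhds_zero_nat T).eventually (gt_mem_nhds hδ)]
    with N hN k hk s hs r hr
  refine (h_modulus s (uIcc_grid_subset hT hk hs) r (uIcc_grid_subset hT hk hr) ?_).le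
  calc dist s r ≤ dist (grid T N k) (grid T N (k + 1)) := Real.dist_le_of_mem_uIcc hs hr
    _ = T / N := by
      rw [dist_comm, Real.dist_eq, grid_succ_sub, abs_of_nonneg (by positivity)]
    _ < δ := hN

theorem abs_sub_sub_sum_le {m s : ℕ → ℝ} {δ : ℝ} {N : ℕ}
    (h : ∀ k < N, |m (k + 1) - m k - s k| ≤ δ) {k : ℕ} (hk : k ≤ N) :
    |m k - m 0 - ∑ j ∈ Finset.range k, s j| ≤ k * δ := by
  rw [← Finset.sum_range_sub, ← Finset.sum_sub_distrib, ← nsmul_eq_mul]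
  refine (Finset.abs_sum_le_sum_abs _ _).trans ?_
  simpa only [Finset.card_range] using Finset.sum_le_card_nsmul _ _ δ fun j hj =>
    h j ((Finset.mem_range.1 hj).trans_le hk)

theorem abs_sub_sum_le_of_grid {m : ℝ → ℝ} {s : ℕ → ℝ} {δ : ℝ} {N : ℕ} (hT : 0 ≤ T) (hδ : 0 ≤ δ)
    (hm : m 0 = 0)
    (h : ∀ k < N, |m (grid T N (k + 1)) - m (grid T N k) - s k| ≤ δ * (T / N)) {k : ℕ}
    (hk : k ≤ N) : |m (grid T N k) - ∑ j ∈ Finset.range k, s j| ≤ δ * T := by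
  have h_telescope := abs_sub_sub_sum_le (m := fun k => m (grid T N k)) h hk
  rw [grid_zero, hm, sub_zero] at h_telescope
  calc |m (grid T N k) - ∑ j ∈ Finset.range k, s j| ≤ k * (δ * (T / N)) := h_telescope
    _ = δ * grid T N k := by rw [grid]; ring
    _ ≤ δ * T := mul_le_mul_of_nonneg_left (grid_mem_Icc hT hk).2 hδ

theorem abs_integral_grid_le {δ : ℝ} {N k : ℕ} (hT : 0 ≤ T)
    (h : ∀ s ∈ uIcc (grid T N k) (grid T N (k + 1)), |g s| ≤ δ) :
    |∫ s in grid T N k..grid T N (k + 1), g s| ≤ δ * (T / N) := by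
  have h_norm := intervalIntegral.norm_integral_le_of_norm_le_const (f := g) fun s hs =>
    h s (uIoc_subset_uIcc hs)
  rwa [grid_succ_sub, abs_of_nonneg (a := T / N) (by positivity)] at h_norm

theorem tendsto_riemann_sum (hg : ContinuousOn g (Icc 0 T)) (hT : 0 ≤ T) :
    Filter.Tendsto (fun N : ℕ => ∑ j ∈ Finset.range N, g (grid T N j) * (T / N)) Filter.atTop
      (nhds (∫ s in (0 : ℝ)..T, g s)) := by
  rw [Metric.tendsto_nhds]
  intro ε hε
  obtain ⟨δ, hδ, hδε⟩ := exists_pos_mul_lt hε T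
  filter_upwards [Filter.eventually_ne_atTop 0, eventually_grid_oscillation_le hg hT hδ]
    with N hN0 hN
  have h_integrable {a b : ℝ} (ha : a ∈ Icc 0 T) (hb : b ∈ Icc 0 T) :
      IntervalIntegrable g volume a b := intervalIntegrable_of_continuousOn_Icc hg ha hb
  have h_cell (k : ℕ) (hk : k < N) :
      |(∫ s in (0 : ℝ)..grid T N (k + 1), g s) - (∫ s in (0 : ℝ)..grid T N k, g s) -
        g (grid T N k) * (T / N)| ≤ δ * (T / N) := by
    have h_left := grid_mem_Icc hT hk.le
    have h_right := grid_mem_Icc hT (Nat.succ_le_of_lt hk)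
    have h_zero : (0 : ℝ) ∈ Icc 0 T := left_mem_Icc.2 hT
    rw [intervalIntegral.integral_interval_sub_left (h_integrable h_zero h_right)
      (h_integrable h_zero h_left), ← grid_succ_sub T N k, mul_comm, ← smul_eq_mul,
      ← intervalIntegral.integral_const, ← intervalIntegral.integral_sub
      (h_integrable h_left h_right) intervalIntegrable_const, grid_succ_sub]
    exact abs_integral_grid_le hT fun s hs => hN k hk s hs _ left_mem_uIcc
  have h_sum := abs_sub_sum_le_of_grid (m := fun t => ∫ s in (0 : ℝ)..t, g s) hT hδ.le
    intervalIntegral.integral_same h_cell le_rfl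
  rw [grid_self T hN0, ← Real.dist_eq, dist_comm] at h_sum
  exact h_sum.trans_lt (by rwa [mul_comm])

theorem continuousOn_pathIntegral (hw : ContinuousOn w (Icc 0 T)) (hw' : ContinuousOn w' (Icc 0 T))
    (hF : ContinuousOn F (Icc 0 T)) (hT : 0 ≤ T) :
    ContinuousOn (pathIntegral w w' F) (Icc 0 T) := by
  have h_primitive := intervalIntegral.continuousOn_primitive_interval (a := 0) (b := T)
    (f := fun s => w' s * F s) (μ := volume) (by
      rw [uIcc_of_le hT]
      exact (hw'.mul hF).integrableOn_Icc)
  rw [uIcc_of_le hT] at h_primitive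
  exact (hw.mul hF).sub h_primitive

theorem pathIntegral_sub_sub_mul (hw : ∀ t ∈ Icc 0 T, HasDerivWithinAt w (w' t) (Icc 0 T) t)
    (hw' : ContinuousOn w' (Icc 0 T)) (hF : ContinuousOn F (Icc 0 T)) {a b : ℝ}
    (ha : a ∈ Icc 0 T) (hb : b ∈ Icc 0 T) :
    pathIntegral w w' F b - pathIntegral w w' F a - w a * (F b - F a) =
      ∫ s in a..b, w' s * (F b - F s) := by
  have h_zero : (0 : ℝ) ∈ Icc 0 T := left_mem_Icc.2 (ha.1.trans ha.2)
  have h_increment : ∫ s in a..b, w' s = w b - w a :=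
    intervalIntegral.integral_eq_sub_of_hasDeriv_right
      (fun t ht => (hw t (uIcc_subset_Icc ha hb ht)).continuousWithinAt.mono
        (uIcc_subset_Icc ha hb))
      (fun t ht => ((hw t (uIcc_subset_Icc ha hb (Ioo_subset_Icc_self ht))).hasDerivAt
        (Icc_mem_nhds ((le_min ha.1 hb.1).trans_lt ht.1)
          (ht.2.trans_le (max_le ha.2 hb.2)))).hasDerivWithinAt)
      (intervalIntegrable_of_continuousOn_Icc hw' ha hb)
  have h_product {a b : ℝ} (ha : a ∈ Icc 0 T) (hb : b ∈ Icc 0 T) :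
      IntervalIntegrable (fun s => w' s * F s) volume a b :=
    intervalIntegrable_of_continuousOn_Icc (hw'.mul hF) ha hb
  simp only [mul_sub]
  rw [intervalIntegral.integral_sub
    ((intervalIntegrable_of_continuousOn_Icc hw' ha hb).mul_const _) (h_product ha hb),
    intervalIntegral.integral_mul_const, h_increment, pathIntegral, pathIntegral,
    ← intervalIntegral.integral_interval_sub_left (h_product h_zero hb) (h_product h_zero ha)]
  ring

theorem eventually_abs_pathIntegral_sub_sum_le
    (hw : ∀ t ∈ Icc 0 T, HasDerivWithinAt w (w' t) (Icc 0 T) t) (hw' : ContinuousOn w' (Icc 0 T))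
    (hF : ContinuousOn F (Icc 0 T)) (hF0 : F 0 = 0) (hT : 0 ≤ T) {ε : ℝ} (hε : 0 < ε) :
    ∀ᶠ N : ℕ in Filter.atTop, ∀ k ≤ N, |pathIntegral w w' F (grid T N k) -
      ∑ j ∈ Finset.range k, w (grid T N j) * (F (grid T N (j + 1)) - F (grid T N j))| ≤ ε := by
  obtain ⟨C, hC⟩ := isCompact_Icc.exists_bound_of_continuousOn hw'
  have hC_nonneg : 0 ≤ C := (norm_nonneg _).trans (hC 0 (left_mem_Icc.2 hT))
  obtain ⟨δ, hδ, hδε⟩ := exists_pos_mul_lt hε (C * T)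
  filter_upwards [eventually_grid_oscillation_le hF hT hδ] with N hN k hk
  have h_cell (k : ℕ) (hk : k < N) :
      |pathIntegral w w' F (grid T N (k + 1)) - pathIntegral w w' F (grid T N k) -
        w (grid T N k) * (F (grid T N (k + 1)) - F (grid T N k))| ≤ C * δ * (T / N) := by
    rw [pathIntegral_sub_sub_mul hw hw' hF (grid_mem_Icc hT hk.le) (grid_mem_Icc hT hk)]
    refine abs_integral_grid_le hT fun s hs => ?_
    rw [abs_mul]
    exact mul_le_mul (hC s (uIcc_grid_subset hT hk hs)) (hN k hk _ right_mem_uIcc s hs)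
      (abs_nonneg _) hC_nonneg
  have h_zero : pathIntegral w w' F 0 = 0 := by
    rw [pathIntegral, hF0, intervalIntegral.integral_same, mul_zero, sub_zero]
  refine (abs_sub_sum_le_of_grid hT (mul_nonneg hC_nonneg hδ.le) h_zero h_cell hk).trans ?_
  rw [mul_right_comm]
  exact hδε.le

theorem eventually_exists_le_abs_sum (hw : ∀ t ∈ Icc 0 T, HasDerivWithinAt w (w' t) (Icc 0 T) t)
    (hw' : ContinuousOn w' (Icc 0 T)) (hF : ContinuousOn F (Icc 0 T)) (hF0 : F 0 = 0) {ε t : ℝ}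
    (ht : t ∈ Icc 0 T) (hε : ε < |pathIntegral w w' F t|) :
    ∀ᶠ N : ℕ in Filter.atTop, ∃ k ≤ N, ε ≤ |∑ j ∈ Finset.range k,
      w (grid T N j) * (F (grid T N (j + 1)) - F (grid T N j))| := by
  have hT : 0 ≤ T := ht.1.trans ht.2
  obtain ⟨ρ, hερ, hρ⟩ := exists_between hε
  have h_tendsto : Filter.Tendsto (fun N : ℕ => |pathIntegral w w' F (grid T N ⌊t / T * N⌋₊)|)
      Filter.atTop (nhds |pathIntegral w w' F t|) :=
    ((continuousOn_pathIntegral (fun t ht => (hw t ht).continuousWithinAt) hw' hF hT).abs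
      t ht).tendsto.comp (tendsto_nhdsWithin_iff.2 ⟨tendsto_grid_floor ht,
        .of_forall fun N => grid_mem_Icc hT (floor_div_mul_le ht N)⟩)
  filter_upwards [eventually_abs_pathIntegral_sub_sum_le hw hw' hF hF0 hT (sub_pos.2 hερ),
    h_tendsto.eventually (lt_mem_nhds hρ)] with N h_sum h_value
  refine ⟨_, floor_div_mul_le ht N, ?_⟩
  linarith [(abs_sub_abs_le_abs_sub _ _).trans (h_sum _ (floor_div_mul_le ht N))]

theorem L2norm_eq_sqrt (hw : ContinuousOn w (Icc 0 T)) (hT : 0 ≤ T) :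
    L2norm T w = √(∫ s in (0 : ℝ)..T, w s ^ 2) := by
  have h_memLp : MemLp w 2 (volume.restrict (Icc 0 T)) := by
    rw [memLp_two_iff_integrable_sq (hw.aestronglyMeasurable measurableSet_Icc)]
    exact (hw.pow 2).integrableOn_Icc
  rw [L2norm, h_memLp.eLpNorm_eq_integral_rpow_norm two_ne_zero ENNReal.ofNat_ne_top,
    ENNReal.toReal_ofReal (by positivity), intervalIntegral.integral_of_le hT,
    ← integral_Icc_eq_integral_Ioc, Real.sqrt_eq_rpow]
  simp

end Riemann

/-! ### The expansion along Brownian paths -/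

section Brownian

variable {Ω : Type*} {mΩ : MeasurableSpace Ω} {P : Measure Ω} {B : ℝ≥0 → Ω → ℝ}
  {w w' x₀ v₁ v₁' v₂ v₂' : ℝ → ℝ} {x : ℕ → ℝ → Ω → ℝ} {T σ : ℝ}

theorem measureReal_exists_le_abs_sum_brownian_le [IsProbabilityMeasure P]
    (hB : IsBrownianReal B P) {τ : ℕ → ℝ≥0} (hτ : Monotone τ) (r : ℕ → ℝ) {ε : ℝ} (hε : 0 < ε)
    (N : ℕ) :
    P.real {ω | ∃ k ≤ N, ε ≤ |∑ j ∈ Finset.range k, r j * (B (τ (j + 1)) ω - B (τ j) ω)|} ≤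
      √(2 / π) * √(∑ j ∈ Finset.range N, r j ^ 2 * (τ (j + 1) - τ j)) / ε := by
  have h_indep : iIndepFun (fun j ω => r j * (B (τ (j + 1)) ω - B (τ j) ω)) P :=
    (hB.hasIndepIncrements.nat hτ).comp (fun j x => r j * x) fun j => by fun_prop
  have h_law (j : ℕ) := gaussianReal_const_mul (hB.hasLaw_sub (τ (j + 1)) (τ j)) (r j)
  simp only [mul_zero, Pi.sub_apply] at h_law
  refine (measureReal_exists_le_abs_sum_gaussian_le h_indep h_law hε N).trans_eq ?_
  congr 3
  refine Finset.sum_congr rfl fun j _ => ?_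
  change r j ^ 2 * |(τ (j + 1) : ℝ) - τ j| = _
  rw [abs_of_nonneg (sub_nonneg.2 (NNReal.coe_le_coe.2 (hτ j.le_succ)))]

theorem measureReal_exists_lt_abs_pathIntegral_le [IsProbabilityMeasure P]
    (hB : IsBrownianReal B P) (hw : ∀ t ∈ Icc 0 T, HasDerivWithinAt w (w' t) (Icc 0 T) t)
    (hw' : ContinuousOn w' (Icc 0 T)) (hT : 0 ≤ T) {ε : ℝ} (hε : 0 < ε) :
    P.real {ω | ∃ t ∈ Icc 0 T, ε < |pathIntegral w w' (fun t => B t.toNNReal ω) t|} ≤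
      √(2 / π) * L2norm T w / ε := by
  have hw_cont : ContinuousOn w (Icc 0 T) := fun t ht => (hw t ht).continuousWithinAt
  have h_riemann : ∀ᵐ ω ∂P,
      (∃ t ∈ Icc 0 T, ε < |pathIntegral w w' (fun t => B t.toNNReal ω) t|) →
      ∀ᶠ N in Filter.atTop, ∃ k ≤ N, ε ≤ |∑ j ∈ Finset.range k, w (grid T N j) *
        (B (grid T N (j + 1)).toNNReal ω - B (grid T N j).toNNReal ω)| := by
    filter_upwards [hB.cont, hB.eval_zero_ae_eq_zero] with ω h_cont h_zero ⟨t, ht, hlt⟩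
    exact eventually_exists_le_abs_sum hw hw' (h_cont.comp continuous_real_toNNReal).continuousOn
      (by simpa only [Function.comp_apply, Real.toNNReal_zero] using h_zero) ht hlt
  have h_grid (N : ℕ) : P.real {ω | ∃ k ≤ N, ε ≤ |∑ j ∈ Finset.range k, w (grid T N j) *
      (B (grid T N (j + 1)).toNNReal ω - B (grid T N j).toNNReal ω)|} ≤
      √(2 / π) * √(∑ j ∈ Finset.range N, w (grid T N j) ^ 2 * (T / N)) / ε := by
    simpa only [Real.coe_toNNReal _ (grid_nonneg hT N _), grid_succ_sub] using
      measureReal_exists_le_abs_sum_brownian_le hB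
        (fun i j hij => Real.toNNReal_mono (grid_mono hT N hij)) (fun j => w (grid T N j)) hε N
  rw [L2norm_eq_sqrt hw_cont hT]
  exact measureReal_le_of_tendsto h_riemann h_grid
    (((tendsto_riemann_sum (hw_cont.pow 2) hT).sqrt.const_mul _).div_const _)

theorem IsHomogeneousSolution.measureReal_exists_lt_abs_pathIntegral_le [IsProbabilityMeasure P]
    (hB : IsBrownianReal B P) (hw : IsHomogeneousSolution x₀ w w') (hT : 0 ≤ T) (hσ : 0 < σ) :
    P.real {ω | ∃ t ∈ Icc 0 T, 1 / σ < |pathIntegral w w' (fun t => B t.toNNReal ω) t|} ≤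
      σ * √(2 / π) * L2norm T w := by
  have h := CubicOscillator.measureReal_exists_lt_abs_pathIntegral_le hB
    (fun t ht => (hw.hasDerivWithinAt_fst t ht.1).mono Icc_subset_Ici_self)
    (hw.continuousOn_snd.mono Icc_subset_Ici_self) hT (one_div_pos.2 hσ)
  rwa [div_div_eq_mul_div, div_one, mul_right_comm, mul_comm _ σ] at h

theorem SolvesLinearized.abs_le_gammaSeq_one_div {F X : ℝ → ℝ} (hx₀ : ContinuousOn x₀ (Ici 0))
    (hF : ContinuousOn F (Ici 0)) (hv₁ : IsHomogeneousSolution x₀ v₁ v₁')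
    (hv₂ : IsHomogeneousSolution x₀ v₂ v₂') (hW : ∀ t, 0 ≤ t → v₁ t * v₂' t - v₁' t * v₂ t = 1)
    (h : SolvesLinearized x₀ F X) {t : ℝ} (ht : 0 ≤ t)
    (h₁ : |pathIntegral v₁ v₁' F t| ≤ 1 / σ) (h₂ : |pathIntegral v₂ v₂' F t| ≤ 1 / σ) :
    |X t| ≤ gammaSeq v₁ v₂ 1 t / σ :=
  calc |X t| = |v₂ t * pathIntegral v₁ v₁' F t - v₁ t * pathIntegral v₂ v₂' F t| := by
        rw [h.eq_pathIntegral hx₀ hF hv₁ hv₂ hW ht]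
    _ ≤ |v₂ t| * |pathIntegral v₁ v₁' F t| + |v₁ t| * |pathIntegral v₂ v₂' F t| := by
        simpa only [abs_mul] using
          abs_sub (v₂ t * pathIntegral v₁ v₁' F t) (v₁ t * pathIntegral v₂ v₂' F t)
    _ ≤ |v₂ t| * (1 / σ) + |v₁ t| * (1 / σ) := by gcongr
    _ = gammaSeq v₁ v₂ 1 t / σ := by
        rw [gammaSeq]
        ring

theorem IsExpansion.ae_forall_abs_le_gammaSeq_div (hB : IsBrownianReal B P)
    (hx₀ : ContinuousOn x₀ (Ici 0)) (hv₁ : IsHomogeneousSolution x₀ v₁ v₁')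
    (hv₂ : IsHomogeneousSolution x₀ v₂ v₂') (hW : ∀ t, 0 ≤ t → v₁ t * v₂' t - v₁' t * v₂ t = 1)
    (hx : IsExpansion P B x₀ x) (T σ : ℝ) :
    ∀ᵐ ω ∂P,
      (∀ t ∈ Icc 0 T, |pathIntegral v₁ v₁' (fun t => B t.toNNReal ω) t| ≤ 1 / σ) →
      (∀ t ∈ Icc 0 T, |pathIntegral v₂ v₂' (fun t => B t.toNNReal ω) t| ≤ 1 / σ) →
      ∀ n, 1 ≤ n → ∀ t ∈ Icc 0 T, |x n t ω| ≤ gammaSeq v₁ v₂ n t / σ ^ n := by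
  have h_higher : ∀ᵐ ω ∂P, ∀ n, 2 ≤ n → SolvesLinearized x₀
      (fun t => ∫ s in (0 : ℝ)..t, ∑ j ∈ Finset.Ico 1 n, x j s ω * x (n - j) s ω)
      (fun t => x n t ω) := by
    simpa only [ae_all_iff] using hx.higher
  filter_upwards [hx.first, h_higher, hB.cont] with ω h_one h_rec h_path h₁ h₂ n hn
  have hx_cont (n : ℕ) (hn : 1 ≤ n) : ContinuousOn (fun t => x n t ω) (Ici 0) := by
    rcases hn.eq_or_lt with rfl | hn
    exacts [h_one.continuousOn, (h_rec n hn).continuousOn]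
  refine abs_le_gammaSeq_div (z := fun n t => x n t ω) hv₁.continuousOn_fst hv₂.continuousOn_fst
    hx_cont (fun n hn t ht => ?_) (fun t ht => ?_) hn
  · exact (h_rec n hn).eq_integral_kernel hx₀
      (continuousOn_sum_convolution fun j hj _ => hx_cont j hj) hv₁ hv₂ hW ht
  · exact h_one.abs_le_gammaSeq_one_div hx₀ (h_path.comp continuous_real_toNNReal).continuousOn
      hv₁ hv₂ hW ht.1 (h₁ t ht) (h₂ t ht)

end Brownian

end CubicOscillator

open CubicOscillator in
theorem mainTheorem3_general {Ω : Type*} [MeasurableSpace Ω] {P : Measure Ω}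
    [IsProbabilityMeasure P] {B : ℝ≥0 → Ω → ℝ} (hB : IsBrownianReal B P)
    {x₀ w₁ w₁' w₂ w₂' : ℝ → ℝ} (hx₀ : ContinuousOn x₀ (Ici 0))
    (hw₁ : IsHomogeneousSolution x₀ w₁ w₁') (hw₂ : IsHomogeneousSolution x₀ w₂ w₂')
    (hW : ∀ t, 0 ≤ t → w₁ t * w₂' t - w₁' t * w₂ t = 1)
    {x : ℕ → ℝ → Ω → ℝ} (hx : IsExpansion P B x₀ x) {σ T : ℝ} (hσ : 0 < σ) (hT : 0 ≤ T) :
    1 - σ * √(2 / Real.pi) * (L2norm T w₁ + L2norm T w₂) ≤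
      P.real {ω | ∀ n, 1 ≤ n → ∀ t ∈ Icc 0 T, |x n t ω| ≤ gammaSeq w₁ w₂ n t / σ ^ n} := by
  set A := {ω | ∀ n, 1 ≤ n → ∀ t ∈ Icc 0 T, |x n t ω| ≤ gammaSeq w₁ w₂ n t / σ ^ n}
  set D₁ := {ω | ∃ t ∈ Icc 0 T, 1 / σ < |pathIntegral w₁ w₁' (fun t => B t.toNNReal ω) t|}
  set D₂ := {ω | ∃ t ∈ Icc 0 T, 1 / σ < |pathIntegral w₂ w₂' (fun t => B t.toNNReal ω) t|}
  have h_cover : A ∪ (D₁ ∪ D₂) ∈ ae P := by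
    filter_upwards [hx.ae_forall_abs_le_gammaSeq_div hB hx₀ hw₁ hw₂ hW T σ] with ω h_bound
    by_contra! h_notMem
    simp only [mem_union, not_or] at h_notMem
    exact h_notMem.1 (h_bound (fun t ht => not_lt.1 fun h => h_notMem.2.1 ⟨t, ht, h⟩)
      fun t ht => not_lt.1 fun h => h_notMem.2.2 ⟨t, ht, h⟩)
  have h_one : 1 ≤ P.real A + (P.real D₁ + P.real D₂) :=
    calc 1 = P.real (A ∪ (D₁ ∪ D₂)) := by
          rw [measureReal_congr (Filter.eventuallyEq_univ.2 h_cover), probReal_univ]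
      _ ≤ P.real A + (P.real D₁ + P.real D₂) :=
          (measureReal_union_le _ _).trans (by gcongr; exact measureReal_union_le _ _)
  have h_D₁ := hw₁.measureReal_exists_lt_abs_pathIntegral_le hB hT hσ
  have h_D₂ := hw₂.measureReal_exists_lt_abs_pathIntegral_le hB hT hσ
  linarith

theorem mainTheorem3 {Ω : Type*} [MeasurableSpace Ω] (P : Measure Ω) [IsProbabilityMeasure P]
    (B : ℝ≥0 → Ω → ℝ) (hB : IsBrownianReal B P)
    (a c y η : ℝ) (hcb : c < -a - c) (hba : -a - c < a) (hy : y ∈ Set.Icc c (-a - c))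
    (hη : CubicOscillator.hamiltonian (CubicOscillator.calB a c) y η = a * c * (a + c) / 3)
    (x₀ : ℝ → ℝ)
    (hx₀ : CubicOscillator.IsUnperturbedSolution (CubicOscillator.calB a c) y η x₀)
    (w₁ w₂ : ℝ → ℝ) (k₁ k₂ : ℝ)
    (hw₁ : w₁ = CubicOscillator.w₁ a c y η k₁) (hw₂ : w₂ = CubicOscillator.w₂ a c y η k₂)
    (hW : ∀ t, 0 ≤ t → w₁ t * deriv w₂ t - deriv w₁ t * w₂ t = 1)
    (x : ℕ → ℝ → Ω → ℝ) (hx : CubicOscillator.IsExpansion P B x₀ x)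
    (σ : ℝ) (hσ : 0 < σ) (T : ℝ) (hT : 0 < T) (n : ℕ) (hn : 1 ≤ n) :
    1 - σ * 2 ^ (n - 2) * Real.sqrt (2 / Real.pi) *
        (CubicOscillator.L2norm T w₁ + CubicOscillator.L2norm T w₂) ≤
      P.real {ω | ∀ t ∈ Set.Icc (0 : ℝ) T,
        |x n t ω| ≤ CubicOscillator.gammaSeq w₁ w₂ n t / σ ^ n} := by
  open CubicOscillator in
  subst hw₁ hw₂
  have h_general := mainTheorem3_general hB hx₀.continuousOn
    (hx₀.isHomogeneousSolution_w₁ hcb hba hy hη k₁) (hx₀.isHomogeneousSolution_w₂ hcb hba hy hη k₂)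
    hW hx hσ hT.le
  have h_const : 0 ≤ σ * √(2 / Real.pi) * (L2norm T (w₁ a c y η k₁) + L2norm T (w₂ a c y η k₂)) :=
    mul_nonneg (by positivity) (add_nonneg ENNReal.toReal_nonneg ENNReal.toReal_nonneg)
  have h_pow : (1 : ℝ) ≤ 2 ^ (n - 2) := one_le_pow₀ one_le_two
  calc _ ≤ 1 - σ * √(2 / Real.pi) * (L2norm T (w₁ a c y η k₁) + L2norm T (w₂ a c y η k₂)) := by
        linarith [mul_le_mul_of_nonneg_right h_pow h_const]
    _ ≤ _ := h_general.trans (measureReal_mono fun ω hω => hω n hn)
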